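/- Let $q$ be a prime power and let $n=\prod_i p_i^{m_i}>1$ be an odd integer (prime factorization with distinct primes $p_i$, $m_i\ge 1$) such that the multiplicative order $\mathrm{ord}_n(q)$ of $q$ modulo $n$ exists and is odd, and such that $p_i\equiv -1 \pmod 4$ for all $i$. Let $t_i=\mathrm{ord}_{p_i}(q^2)$ and let $z_i$ be defined by $p_i^{z_i}\,\|\,q^{2t_i}-1$, that is, $p_i^{z_i}$ divides $q^{2t_i}-1$ but $p_i^{z_i+1}$ does not. Suppose that $m_i>2z_i$ for all $i$. Then there exist integers $d,d'$ and an $[[n,1,d]]_q$ quantum stabilizer code $Q\subseteq\mathbf{C}^{q^n}$ of dimension $q$ and minimum distance exactly $d$ with the following properties. (1) $Q$ is a Hermitian quantum duadic code: there are a primitive $n$-th root of unity $\alpha$ over $\mathbf F_{q^2}$ and a partition of $\{1,\dots,n-1\}$ into two sets $S_0,S_1$, each invariant under multiplication by $q^2$ modulo $n$ and interchanged by multiplication by $-q$ modulo $n$, such that for the cyclic code $D=\{c\in\mathbf F_{q^2}^n:\sum_{i=0}^{n-1} c_i\alpha^{ij}=0 \text{ for all } j\in S_0\}$ and its even-like subcode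 $C=\{c\in D:\sum_i c_i=0\}$ one has $C^{\perp_h}=D$ (Hermitian dual over $\mathbf F_{q^2}$), and $Q$ is obtained from $C\subseteq C^{\perp_h}$ by the Hermitian construction; i.e. for some normal basis $(\beta,\beta^q)$ of $\mathbf F_{q^2}$ over $\mathbf F_q$, the stabilizer group of $Q$ consists, up to phases, of exactly the error operators $X(a)Z(b)$ with $a,b\in\mathbf F_q^n$ and $\beta a+\beta^q b\in C$. (2) $d^2-d+1\ge n$. (3) $Q$ is degenerate and pure exactly to $d'$, where $d'\le\min_i p_i^{z_i}<d$. Here, with $p$ the characteristic of $\mathbf F_q$ and $\mathrm{tr}$ the absolute trace, $X(a)|x\rangle=|x+a\rangle$ and $Z(b)|x\rangle=e^{2\pi i\,\mathrm{tr}(b\cdot x)/p}|x\rangle$, the weight of $E=X(a)Z(b)$ is the number of positions $j$ with $(a_j,b_j)\ne(0,0)$, the minimum distance of $Q$ is the largest $d$ such that $\langle u|E|u\rangle=\langle v|E|v\rangle$ for all such $E$ of weight less than $d$ and all unit vectors $u,v\in Q$; $Q$ is pure to $t$ if $\langle v|E|v\rangle=q^{-n}\operatorname{tr}E$ for all such $E$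 of weight less than $t$ and all unit vectors $v\in Q$, it is pure exactly to $d'$ if $d'$ is the largest such $t$, and it is degenerate if it is not pure to its minimum distance. -/

import Mathlib

open Matrix

namespace QDuadic

noncomputable section

/-! ### Error operators and quantum codes on `ℂ^(q^n)`

`F` is the field with `q` elements; a vector of `ℂ^(q^n)` is a function
`(Fin n → F) → ℂ`, whose value at `x` is the coefficient of the basis state `|x⟩`. -/

section Quantum

variable {F : Type*} [Field F] [Fintype F] [DecidableEq F] {n : ℕ}

/-- The additive character `x ↦ exp (2πi tr(x) / p)` of `F`, with `tr` the absolute trace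
and `p` the characteristic. -/
def chi (F : Type*) [Field F] [Fintype F] (x : F) : ℂ :=
  letI : Algebra (ZMod (ringChar F)) F := ZMod.algebra F (ringChar F)
  Complex.exp (2 * Real.pi * Complex.I *
    ((Algebra.trace (ZMod (ringChar F)) F x).val : ℂ) / (ringChar F : ℂ))

/-- The shift operator `X(a) |x⟩ = |x + a⟩`. -/
def opX (a : Fin n → F) : Matrix (Fin n → F) (Fin n → F) ℂ :=
  Matrix.of fun y x => if y = x + a then 1 else 0

/-- The phase operator `Z(b) |x⟩ = exp (2πi tr(b · x) / p) |x⟩`. -/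
def opZ (b : Fin n → F) : Matrix (Fin n → F) (Fin n → F) ℂ :=
  Matrix.diagonal fun x => chi F (b ⬝ᵥ x)

/-- The error operator `X(a) Z(b)`. These operators are a basis of all operators
on `ℂ^(q^n)`. -/
def errorOp (a b : Fin n → F) : Matrix (Fin n → F) (Fin n → F) ℂ :=
  opX a * opZ b

/-- The weight of `X(a) Z(b)`: the number of tensor factors that are not scalar. -/
def errorWeight (a b : Fin n → F) : ℕ :=
  (Finset.univ.filter fun i => a i ≠ 0 ∨ b i ≠ 0).card

/-- `⟨v| E |v⟩`. -/
def expectation (E : Matrix (Fin n → F) (Fin n → F) ℂ) (v : (Fin n → F) → ℂ) : ℂ :=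
  star v ⬝ᵥ (E *ᵥ v)

/-- `v` is a unit vector. -/
def IsState (v : (Fin n → F) → ℂ) : Prop := star v ⬝ᵥ v = 1

/-- `⟨u|E|u⟩ = ⟨v|E|v⟩` for all states `u`, `v` of `Q` and all errors of weight `< d`. -/
def Detects (Q : Submodule ℂ ((Fin n → F) → ℂ)) (d : ℕ) : Prop :=
  ∀ a b : Fin n → F, errorWeight a b < d → ∀ u ∈ Q, ∀ v ∈ Q, IsState u → IsState v →
    expectation (errorOp a b) u = expectation (errorOp a b) v

/-- `d` is the minimum distance of `Q`. -/
def IsMinDistance (Q : Submodule ℂ ((Fin n → F) → ℂ)) (d : ℕ) : Prop :=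
  IsGreatest {t | Detects Q t} d

/-- `Q` is pure to `t`: `⟨v|E|v⟩ = q⁻ⁿ tr E` for all states `v` of `Q` and all errors `E`
of weight `< t`. -/
def IsPureTo (Q : Submodule ℂ ((Fin n → F) → ℂ)) (t : ℕ) : Prop :=
  ∀ a b : Fin n → F, errorWeight a b < t → ∀ v ∈ Q, IsState v →
    expectation (errorOp a b) v = ((Fintype.card F : ℂ) ^ n)⁻¹ * (errorOp a b).trace

/-- `Q` is degenerate: it is not pure to its minimum distance. -/
def IsDegenerate (Q : Submodule ℂ ((Fin n → F) → ℂ)) : Prop :=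
  ∃ d, IsMinDistance Q d ∧ ¬ IsPureTo Q d

/-- `Q` is the stabilizer code with stabilizer `S`: a nonzero joint eigenspace, with
eigenvalue `1`, of a group of unitary multiples of error operators.
(Since `Q` is nonzero, `S` is abelian and contains no scalar other than `1`.) -/
def IsStabilizerCode (S : Subgroup (Matrix.unitaryGroup (Fin n → F) ℂ))
    (Q : Submodule ℂ ((Fin n → F) → ℂ)) : Prop :=
  (∀ E ∈ S, ∃ (c : ℂ) (a b : Fin n → F),
      (E : Matrix (Fin n → F) (Fin n → F) ℂ) = c • errorOp a b) ∧
  Q ≠ ⊥ ∧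
  ∀ v, v ∈ Q ↔ ∀ E ∈ S, (E : Matrix (Fin n → F) (Fin n → F) ℂ) *ᵥ v = v

/-- `Q` is an `[[n, k, d]]_q` stabilizer code, with `d` its minimum distance. -/
def IsStabilizerCodeWithParams (Q : Submodule ℂ ((Fin n → F) → ℂ)) (k d : ℕ) : Prop :=
  (∃ S, IsStabilizerCode S Q) ∧ Module.finrank ℂ Q = Fintype.card F ^ k ∧ IsMinDistance Q d

end Quantum

/-! ### Classical duadic codes -/

section Classical

variable {K : Type*} [Field K] {n : ℕ}

/-- `S₀`, `S₁` is a splitting of `n` given by `μ_a : i ↦ a i`, for codes over the field with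
`r` elements: both sets are unions of `r`-ary cyclotomic cosets modulo `n`, they partition the
nonzero residues, and multiplication by `a` interchanges them. -/
def IsSplitting (r : ℕ) (S₀ S₁ : Set (ZMod n)) (a : ZMod n) : Prop :=
  (∀ s ∈ S₀, (r : ZMod n) * s ∈ S₀) ∧ (∀ s ∈ S₁, (r : ZMod n) * s ∈ S₁) ∧
  S₀ ∩ S₁ = ∅ ∧ S₀ ∪ S₁ = {0}ᶜ ∧
  IsUnit a ∧ (fun s => a * s) '' S₀ = S₁ ∧ (fun s => a * s) '' S₁ = S₀

/-- The cyclic code of length `n` over `K` with defining set `S`, relative to the primitive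
`n`-th root of unity `α`: the words `c` with `c(α^j) = 0` for all `j ∈ S`. -/
def cyclicCode (α : AlgebraicClosure K) (S : Set (ZMod n)) : Submodule K (Fin n → K) where
  carrier := {c | ∀ j ∈ S,
    ∑ i : Fin n, algebraMap K (AlgebraicClosure K) (c i) * (α ^ j.val) ^ (i : ℕ) = 0}
  zero_mem' := by
    intro j _
    simp
  add_mem' := by
    intro x y hx hy j hj
    simp only [Pi.add_apply, map_add, add_mul, Finset.sum_add_distrib, hx j hj, hy j hj, add_zero]
  smul_mem' := by
    intro t x hx j hj
    simp only [Pi.smul_apply, smul_eq_mul, map_mul, mul_assoc, ← Finset.mul_sum, hx j hj, mul_zero]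

/-- The even-like subcode of `D`: its words whose coordinates sum to zero. -/
def evenLike (D : Submodule K (Fin n → K)) : Submodule K (Fin n → K) where
  carrier := {c | c ∈ D ∧ ∑ i, c i = 0}
  zero_mem' := ⟨D.zero_mem, by simp⟩
  add_mem' := by
    rintro x y ⟨hx, hx'⟩ ⟨hy, hy'⟩
    exact ⟨D.add_mem hx hy, by simp [Finset.sum_add_distrib, hx', hy']⟩
  smul_mem' := by
    rintro t x ⟨hx, hx'⟩
    exact ⟨D.smul_mem t hx, by simp [← Finset.mul_sum, hx']⟩

/-- The Hermitian dual code of `C`, over the field with `q²` elements. -/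
def hermitianDual (q : ℕ) (C : Submodule K (Fin n → K)) : Submodule K (Fin n → K) where
  carrier := {x | ∀ c ∈ C, ∑ i, x i * c i ^ q = 0}
  zero_mem' := by
    intro c _
    simp
  add_mem' := by
    intro x y hx hy c hc
    simp only [Pi.add_apply, add_mul, Finset.sum_add_distrib, hx c hc, hy c hc, add_zero]
  smul_mem' := by
    intro t x hx c hc
    simp only [Pi.smul_apply, smul_eq_mul, mul_assoc, ← Finset.mul_sum, hx c hc, mul_zero]

end Classical

/-! ### The Hermitian construction -/

section Hermitian

variable {F : Type*} [Field F] [Fintype F] [DecidableEq F] {n : ℕ}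
variable {K : Type*} [Field K] [Algebra F K]

/-- `Q` is obtained from the Hermitian self-orthogonal code `C` over `K` (the quadratic extension
of `F`) by the Hermitian construction: for some normal basis `(β, β^q)` of `K` over `F`, `Q` is a
stabilizer code whose stabilizer consists, up to phases, of the `X(a) Z(b)` with
`β a + β^q b ∈ C`. -/
def IsHermitianConstruction (C : Submodule K (Fin n → K))
    (Q : Submodule ℂ ((Fin n → F) → ℂ)) : Prop :=
  C ≤ hermitianDual (Fintype.card F) C ∧
  ∃ β : K, LinearIndependent F ![β, β ^ Fintype.card F] ∧
  ∃ S : Subgroup (Matrix.unitaryGroup (Fin n → F) ℂ), IsStabilizerCode S Q ∧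
    ∀ a b : Fin n → F,
      (∃ E ∈ S, ∃ c : ℂ, (E : Matrix (Fin n → F) (Fin n → F) ℂ) = c • errorOp a b) ↔
      (fun i => algebraMap F K (a i) * β + algebraMap F K (b i) * β ^ Fintype.card F) ∈ C

/-- `Q` is a Hermitian quantum duadic code: it arises by the Hermitian construction from the
even-like code `C₀` of a pair `C₀ ⊂ D₀ = C₀^{⊥h}` of duadic codes over `K`, the field with `q²`
elements, whose splitting is given by `μ_{-q}`. -/
def IsHermitianQuantumDuadicCode (K : Type*) [Field K] [Algebra F K]
    (Q : Submodule ℂ ((Fin n → F) → ℂ)) : Prop :=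
  ∃ (α : AlgebraicClosure K) (S₀ S₁ : Set (ZMod n)),
    IsPrimitiveRoot α n ∧
    IsSplitting (Fintype.card F ^ 2) S₀ S₁ (-(Fintype.card F : ZMod n)) ∧
    hermitianDual (Fintype.card F) (evenLike (cyclicCode α S₀)) = cyclicCode α S₀ ∧
    IsHermitianConstruction (evenLike (cyclicCode α S₀)) Q

end Hermitian

end

end QDuadic

/-! Write `N = p ^ z p` for the prime `p` minimizing this value. As `2 * z p < n.factorization p`,
the number `p ^ (2 * z p + 1)` divides `n`, so `N` divides `n` and `N * N < n`. It suffices to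
choose the splitting so that `D` has a nonzero word of weight at most `N`, while every odd-like word
of `D` has weight `d` with `d ^ 2 - d + 1 ≥ n`, hence `d > N`.

Classical side. Since `q` has odd order modulo the odd number `n`, `-1` is not a power of `q` modulo
any divisor `N > 1`. The set `T` of residues that reduce to powers of `q` modulo `N` is therefore
disjoint from `-T`, and `-T` extends to a half system `U` (`exists_isHalfSystem`), used as defining
set. The word whose transform is the indicator of `T` lies in `D`; as `T` is periodic modulo `N`,
the word is supported on multiples of `n / N` (`exists_word_of_periodic`). Because `U` is stable
under `q`, the splitting by `-q` is also one by `-1`, which yields the square root bound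
(`le_sq_sub_add_one_of_oddLike`) and, by Parseval, the duality of `C` and `D`
(`hermitianDual_evenLike_cyclicCode`).

Quantum side. Through a normal basis, `C ⊆ D` becomes an isotropic space `A` of error labels inside
its symplectic dual `B`, and `Q` is a joint eigenspace of the commuting operators labelled by `A`.
Errors in `A` act on `Q` as nonzero scalars, errors outside `B` have expectation zero, and errors in
`B \ A` preserve `Q` without being scalar on it. So the minimum distance is the least weight in `D \
C` and the exact purity is the least weight in `D \ {0}` (`IsEigencharacter.detects_iff`,
`IsEigencharacter.isPureTo_iff`). A trace computation gives `dim Q = q`. -/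

namespace QDuadic

/-! ### The additive character of the finite field. -/

section Characters

variable (F : Type*) [Field F] [Fintype F]

instance ringChar_neZero : NeZero (ringChar F) :=
  ⟨(CharP.char_is_prime F (ringChar F)).ne_zero⟩

lemma chi_eq_stdAddChar (x : F) :
    letI : Algebra (ZMod (ringChar F)) F := ZMod.algebra F (ringChar F)
    chi F x = ZMod.stdAddChar (Algebra.trace (ZMod (ringChar F)) F x) := by
  rw [ZMod.stdAddChar_apply, ZMod.toCircle_apply]
  rfl

@[simp] lemma chi_zero : chi F 0 = 1 := by
  rw [chi_eq_stdAddChar, map_zero, AddChar.map_zero_eq_one]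

lemma chi_add (x y : F) : chi F (x + y) = chi F x * chi F y := by
  simp only [chi_eq_stdAddChar, map_add, AddChar.map_add_eq_mul]

lemma chi_mul_chi_neg (x : F) : chi F x * chi F (-x) = 1 := by
  rw [← chi_add, add_neg_cancel, chi_zero]

lemma chi_neg_mul_chi (x : F) : chi F (-x) * chi F x = 1 := by
  rw [← chi_add, neg_add_cancel, chi_zero]

lemma chi_ne_zero (x : F) : chi F x ≠ 0 := left_ne_zero_of_mul_eq_one (chi_mul_chi_neg F x)

lemma star_chi (x : F) : star (chi F x) = chi F (-x) := by
  have h : star (chi F x) * chi F x = 1 := by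
    rw [chi_eq_stdAddChar, ZMod.stdAddChar_apply]
    change (starRingEnd ℂ) _ * _ = 1
    rw [mul_comm, Complex.mul_conj, Circle.normSq_coe, Complex.ofReal_one]
  exact mul_right_cancel₀ (chi_ne_zero F x) (h.trans (chi_neg_mul_chi F x).symm)

variable {F}

lemma exists_chi_mul_ne_one {a : F} (ha : a ≠ 0) : ∃ b, chi F (a * b) ≠ 1 := by
  let : Algebra (ZMod (ringChar F)) F := ZMod.algebra F (ringChar F)
  obtain ⟨b, hb⟩ := FiniteField.trace_to_zmod_nondegenerate F ha
  refine ⟨b, fun h => hb ?_⟩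
  rw [chi_eq_stdAddChar, ← AddChar.map_zero_eq_one (ZMod.stdAddChar (N := ringChar F))] at h
  exact ZMod.injective_stdAddChar h

lemma exists_chi_dotProduct_ne_one {n : ℕ} {b : Fin n → F} (hb : b ≠ 0) :
    ∃ x, chi F (b ⬝ᵥ x) ≠ 1 := by
  obtain ⟨i, hi⟩ := Function.ne_iff.mp hb
  obtain ⟨c, hc⟩ := exists_chi_mul_ne_one hi
  exact ⟨Pi.single i c, by simpa using hc⟩

end Characters

/-! ### Common eigenvectors of commuting operators. -/

section CommonEigenvector

/-- In a minimal nonzero subspace invariant under the whole family, the eigenspace of any one member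
is again invariant by commutativity, so it is everything. -/
lemma exists_common_eigenvector {ι V : Type*} [AddCommGroup V] [Module ℂ V]
    [FiniteDimensional ℂ V] [Nontrivial V] (f : ι → Module.End ℂ V)
    (hc : ∀ i j, Commute (f i) (f j)) :
    ∃ u : V, u ≠ 0 ∧ ∀ i, ∃ c : ℂ, f i u = c • u := by
  obtain ⟨W, ⟨hW, hinv⟩, hmin⟩ := WellFounded.has_min
    (wellFounded_lt (α := Submodule ℂ V))
    {W | W ≠ ⊥ ∧ ∀ i, ∀ x ∈ W, f i x ∈ W} ⟨⊤, top_ne_bot, by simp⟩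
  obtain ⟨u, huW, hu⟩ := (Submodule.ne_bot_iff W).mp hW
  have : Nontrivial W := ⟨⟨u, huW⟩, 0, by simpa [Subtype.ext_iff] using hu⟩
  refine ⟨u, hu, fun i => ?_⟩
  obtain ⟨μ, hμ⟩ := Module.End.exists_eigenvalue ((f i).restrict (hinv i))
  obtain ⟨w, hw⟩ := hμ.exists_hasEigenvector
  refine ⟨μ, ?_⟩
  have hwi : f i w = μ • (w : V) := congrArg Subtype.val hw.apply_eq_smul
  have hmem : W ⊓ (f i).eigenspace μ ∈ {W : Submodule ℂ V | W ≠ ⊥ ∧ ∀ i, ∀ x ∈ W, f i x ∈ W} := by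
    refine ⟨(Submodule.ne_bot_iff _).mpr ⟨w, ⟨w.2, Module.End.mem_eigenspace_iff.mpr hwi⟩, ?_⟩, ?_⟩
    · simpa using hw.2
    · rintro j x ⟨hx, hx'⟩
      refine ⟨hinv j x hx, Module.End.mem_eigenspace_iff.mpr ?_⟩
      rw [← Module.End.mul_apply, (hc i j).eq, Module.End.mul_apply,
        Module.End.mem_eigenspace_iff.mp hx', map_smul]
  have heq : W ⊓ (f i).eigenspace μ = W := by
    by_contra h
    exact hmin _ hmem (lt_of_le_of_ne inf_le_left h)
  have hu' : u ∈ W ⊓ (f i).eigenspace μ := by rwa [heq]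
  exact Module.End.mem_eigenspace_iff.mp hu'.2

end CommonEigenvector

/-! ### The symplectic form. -/

section SymplecticForm

variable {F : Type*} [Field F] {n : ℕ}

/-- The symplectic form on pairs of words. -/
def symp (v w : (Fin n → F) × (Fin n → F)) : F := v.2 ⬝ᵥ w.1 - w.2 ⬝ᵥ v.1

lemma symp_swap (v w : (Fin n → F) × (Fin n → F)) : symp w v = -symp v w := by
  simp [symp]

lemma symp_smul_right (v w : (Fin n → F) × (Fin n → F)) (c : F) :
    symp v (c • w) = symp v w * c := by
  simp [symp, dotProduct_smul, smul_dotProduct]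
  ring

end SymplecticForm

/-! ### Algebra of the error operators. -/

section ErrorOperators

variable {F : Type*} [Field F] [Fintype F] [DecidableEq F] {n : ℕ}

lemma errorOp_apply (a b x y : Fin n → F) :
    errorOp a b y x = if y = x + a then chi F (b ⬝ᵥ x) else 0 := by
  simp [errorOp, opX, opZ, Matrix.mul_diagonal]

lemma errorOp_mul (a b a' b' : Fin n → F) :
    errorOp a b * errorOp a' b' = chi F (b ⬝ᵥ a') • errorOp (a + a') (b + b') := by
  ext y x
  simp only [Matrix.mul_apply, errorOp_apply, Matrix.smul_apply, smul_eq_mul, mul_ite, mul_zero,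
    Finset.sum_ite_eq', Finset.mem_univ, if_true]
  simp only [ite_mul, zero_mul, add_assoc, add_comm a a', add_dotProduct, dotProduct_add, chi_add]
  split_ifs <;> ring

@[simp] lemma errorOp_zero : errorOp (0 : Fin n → F) 0 = 1 := by
  ext y x
  simp [errorOp_apply, Matrix.one_apply]

lemma errorOp_conjTranspose (a b : Fin n → F) :
    (errorOp a b)ᴴ = chi F (b ⬝ᵥ a) • errorOp (-a) (-b) := by
  ext y x
  simp only [Matrix.conjTranspose_apply, errorOp_apply, Matrix.smul_apply, smul_eq_mul]
  by_cases h : x = y + a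
  · subst h
    simp only [neg_dotProduct, dotProduct_add, chi_add, star_chi, add_neg_cancel_right,
      if_true]
    linear_combination -(chi F (-(b ⬝ᵥ y))) * chi_mul_chi_neg F (b ⬝ᵥ a)
  · have h' : ¬ y = x + -a := fun h' => h (by rw [h', neg_add_cancel_right])
    simp [h, h']

lemma errorOp_mul_conjTranspose (a b : Fin n → F) : errorOp a b * (errorOp a b)ᴴ = 1 := by
  rw [errorOp_conjTranspose, Matrix.mul_smul, errorOp_mul, smul_smul]
  simp [chi_mul_chi_neg]

lemma errorOp_conjTranspose_mul (a b : Fin n → F) : (errorOp a b)ᴴ * errorOp a b = 1 :=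
  mul_eq_one_comm.mp (errorOp_mul_conjTranspose a b)

lemma errorOp_ne_zero (a b : Fin n → F) : errorOp a b ≠ 0 := fun h => by
  simpa [h] using errorOp_mul_conjTranspose a b

lemma errorOp_mulVec_ne_zero {a b : Fin n → F} {v : (Fin n → F) → ℂ} (hv : v ≠ 0) :
    errorOp a b *ᵥ v ≠ 0 := fun h => hv <| by
  rw [← Matrix.one_mulVec v, ← errorOp_conjTranspose_mul a b, ← Matrix.mulVec_mulVec, h,
    Matrix.mulVec_zero]

lemma errorOp_trace {a b : Fin n → F} (h : (a, b) ≠ 0) : (errorOp a b).trace = 0 := by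
  simp only [Matrix.trace, Matrix.diag, errorOp_apply]
  by_cases ha : a = 0
  · subst ha
    have hb : b ≠ 0 := fun hb => h (by rw [hb]; rfl)
    obtain ⟨y, hy⟩ := exists_chi_dotProduct_ne_one hb
    simp only [add_zero, if_true]
    -- Translating the summation variable by `y` multiplies the sum by a factor different from `1`.
    have hs : ∑ x, chi F (b ⬝ᵥ x) = chi F (b ⬝ᵥ y) * ∑ x, chi F (b ⬝ᵥ x) := by
      rw [Finset.mul_sum, ← Equiv.sum_comp (Equiv.addLeft y)]
      simp [dotProduct_add, chi_add]
    by_contra hne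
    exact hy (mul_right_cancel₀ hne (by rw [one_mul]; exact hs.symm))
  · exact Finset.sum_eq_zero fun x _ => if_neg (by simpa using ha)

/-- Multiplying by `errorOp (-a) (-b)` makes the left side a nonzero scalar matrix; the right side
would be traceless if the labels differed. -/
lemma errorOp_proportional {a b a' b' : Fin n → F} {c : ℂ}
    (h : errorOp a b = c • errorOp a' b') : a = a' ∧ b = b' := by
  have hc : c ≠ 0 := fun hc => errorOp_ne_zero a b (by rw [h, hc, zero_smul])
  have h1 : (errorOp (-a) (-b) * errorOp a b).trace =
      (errorOp (-a) (-b) * (c • errorOp a' b')).trace := by rw [h]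
  rw [Matrix.mul_smul, errorOp_mul, errorOp_mul] at h1
  by_contra hne
  have h2 : (-a + a', -b + b') ≠ 0 := fun h2 => hne <| by
    obtain ⟨h3, h4⟩ := Prod.mk.inj h2
    exact ⟨neg_add_eq_zero.mp h3, neg_add_eq_zero.mp h4⟩
  simp [Matrix.trace_smul, errorOp_trace h2, chi_ne_zero] at h1

lemma errorOp_mul_comm (v w : (Fin n → F) × (Fin n → F)) :
    errorOp v.1 v.2 * errorOp w.1 w.2 =
      chi F (symp v w) • (errorOp w.1 w.2 * errorOp v.1 v.2) := by
  rw [errorOp_mul, errorOp_mul, smul_smul, ← chi_add, symp, sub_add_cancel, add_comm v.1,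
    add_comm v.2]

end ErrorOperators

/-! ### Normalization and polarization. -/

section HermitianInner

variable {ι : Type*} [Fintype ι]

lemma exists_isState_smul {x : ι → ℂ} (hx : x ≠ 0) :
    ∃ c : ℂ, c ≠ 0 ∧ star (c • x) ⬝ᵥ (c • x) = 1 := by
  have h1 : star x ⬝ᵥ x = ((∑ i, ‖x i‖ ^ 2 : ℝ) : ℂ) := by
    simp only [dotProduct, Pi.star_apply, RCLike.star_def, Complex.conj_mul']
    push_cast
    rfl
  have h2 : 0 < ∑ i, ‖x i‖ ^ 2 := by
    obtain ⟨i, hi⟩ := Function.ne_iff.mp hx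
    exact Finset.sum_pos' (fun _ _ => by positivity)
      ⟨i, Finset.mem_univ i, by have := norm_pos_iff.mpr hi; positivity⟩
  set s := ∑ i, ‖x i‖ ^ 2
  have h3 : Real.sqrt s ≠ 0 := (Real.sqrt_pos.mpr h2).ne'
  refine ⟨((Real.sqrt s)⁻¹ : ℝ), by exact_mod_cast inv_ne_zero h3, ?_⟩
  rw [star_smul, smul_dotProduct, dotProduct_smul, h1, RCLike.star_def, Complex.conj_ofReal,
    smul_eq_mul, smul_eq_mul]
  norm_cast
  nth_rw 3 [← Real.mul_self_sqrt h2.le]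
  field_simp

/-- Polarization: an operator leaving `Q` invariant whose expectation is constant on the unit
vectors of `Q` is scalar on `Q`. -/
lemma eq_smul_of_expectation_const [DecidableEq ι] {Q : Submodule ℂ (ι → ℂ)} {E : Matrix ι ι ℂ}
    (hE : ∀ x ∈ Q, E *ᵥ x ∈ Q) {κ : ℂ}
    (h : ∀ x ∈ Q, star x ⬝ᵥ x = 1 → star x ⬝ᵥ (E *ᵥ x) = κ) :
    ∀ x ∈ Q, E *ᵥ x = κ • x := by
  set D : Matrix ι ι ℂ := E - κ • 1 with hD
  have hDx : ∀ x, D *ᵥ x = E *ᵥ x - κ • x := fun x => by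
    rw [hD, Matrix.sub_mulVec, Matrix.smul_mulVec, Matrix.one_mulVec]
  have h0 : ∀ x ∈ Q, star x ⬝ᵥ (D *ᵥ x) = 0 := by
    intro x hx
    by_cases hx0 : x = 0
    · simp [hx0]
    obtain ⟨c, hc, hs⟩ := exists_isState_smul hx0
    have h1 := h (c • x) (Q.smul_mem c hx) hs
    rw [← mul_one κ, ← hs, ← smul_eq_mul, ← dotProduct_smul, ← sub_eq_zero, ← dotProduct_sub,
      ← hDx, Matrix.mulVec_smul, star_smul, smul_dotProduct, dotProduct_smul, smul_eq_mul,
      smul_eq_mul] at h1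
    simpa [hc] using h1
  have hpol : ∀ x ∈ Q, ∀ y ∈ Q, star x ⬝ᵥ (D *ᵥ y) = 0 := by
    intro x hx y hy
    have h1 := h0 (x + y) (Q.add_mem hx hy)
    have h2 := h0 (x + Complex.I • y) (Q.add_mem hx (Q.smul_mem _ hy))
    simp only [star_add, star_smul, Matrix.mulVec_add, Matrix.mulVec_smul, add_dotProduct,
      dotProduct_add, smul_dotProduct, dotProduct_smul, h0 x hx, h0 y hy, smul_eq_mul,
      RCLike.star_def, Complex.conj_I] at h1 h2
    have hI := Complex.I_mul_I
    linear_combination (1 / 2 : ℂ) * h1 - (Complex.I / 2) * h2 +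
      ((star x ⬝ᵥ (D *ᵥ y)) / 2 - (star y ⬝ᵥ (D *ᵥ x)) / 2) * hI
  intro x hx
  have hmem : D *ᵥ x ∈ Q := by
    rw [hDx]
    exact Q.sub_mem (hE x hx) (Q.smul_mem _ hx)
  rw [← sub_eq_zero, ← hDx]
  -- `D *ᵥ x` lies in `Q`, so `hpol` makes it orthogonal to itself.
  by_contra hne
  obtain ⟨c, hc, hs⟩ := exists_isState_smul hne
  rw [star_smul, smul_dotProduct, dotProduct_smul, hpol _ hmem _ hx] at hs
  simp at hs

end HermitianInner

/-! ### Stabilizer codes from isotropic subspaces. -/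

section Stabilizer

variable {F : Type*} [Field F] [Fintype F] [DecidableEq F] {n : ℕ}
  {A : Submodule F ((Fin n → F) × (Fin n → F))} {u : (Fin n → F) → ℂ}
  {l : (Fin n → F) × (Fin n → F) → ℂ}

/-- `u` is a common eigenvector of the error operators in `A`, with eigenvalues `l`. -/
structure IsEigencharacter (A : Submodule F ((Fin n → F) × (Fin n → F)))
    (u : (Fin n → F) → ℂ) (l : (Fin n → F) × (Fin n → F) → ℂ) : Prop where
  ne_zero : u ≠ 0
  apply_eq : ∀ v ∈ A, errorOp v.1 v.2 *ᵥ u = l v • u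

lemma exists_isEigencharacter (hA : ∀ v ∈ A, ∀ w ∈ A, symp v w = 0) :
    ∃ u l, IsEigencharacter A u l := by
  obtain ⟨u, hu, h⟩ := exists_common_eigenvector
    (fun v : A => Matrix.toLin' (errorOp v.1.1 v.1.2)) (fun v w => by
      rw [Commute, SemiconjBy, Module.End.mul_eq_comp, Module.End.mul_eq_comp,
        ← Matrix.toLin'_mul, ← Matrix.toLin'_mul, errorOp_mul_comm, hA _ v.2 _ w.2, chi_zero,
        one_smul])
  classical
  choose c hc using h
  refine ⟨u, fun v => if hv : v ∈ A then c ⟨v, hv⟩ else 0, hu, fun v hv => ?_⟩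
  simpa [hv] using hc ⟨v, hv⟩

/-- The common eigenspace of the error operators in `A` with eigenvalues `l`. -/
def eigenCode (A : Submodule F ((Fin n → F) × (Fin n → F)))
    (l : (Fin n → F) × (Fin n → F) → ℂ) : Submodule ℂ ((Fin n → F) → ℂ) where
  carrier := {x | ∀ v ∈ A, errorOp v.1 v.2 *ᵥ x = l v • x}
  zero_mem' := fun v _ => by simp
  add_mem' := fun hx hy v hv => by rw [Matrix.mulVec_add, hx v hv, hy v hv, smul_add]
  smul_mem' := fun c x hx v hv => by rw [Matrix.mulVec_smul, hx v hv, smul_comm]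

/-- The unitary multiples of the error operators in `A` that fix `u`. -/
def stabilizerGroup (A : Submodule F ((Fin n → F) × (Fin n → F)))
    (u : (Fin n → F) → ℂ) : Subgroup (Matrix.unitaryGroup (Fin n → F) ℂ) where
  carrier := {U | (∃ c : ℂ, ∃ v ∈ A, (U : Matrix (Fin n → F) (Fin n → F) ℂ) =
    c • errorOp v.1 v.2) ∧ (U : Matrix (Fin n → F) (Fin n → F) ℂ) *ᵥ u = u}
  one_mem' := ⟨⟨1, 0, A.zero_mem, by simp⟩, by simp⟩
  mul_mem' := by
    rintro U V ⟨⟨c, v, hv, hU⟩, hUu⟩ ⟨⟨c', w, hw, hV⟩, hVu⟩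
    refine ⟨⟨c * c' * chi F (v.2 ⬝ᵥ w.1), v + w, A.add_mem hv hw, ?_⟩, ?_⟩
    · rw [Submonoid.coe_mul, hU, hV, Matrix.smul_mul, Matrix.mul_smul, errorOp_mul, smul_smul,
        smul_smul]
      rfl
    · rw [Submonoid.coe_mul, ← Matrix.mulVec_mulVec, hVu, hUu]
  inv_mem' := by
    rintro U ⟨⟨c, v, hv, hU⟩, hUu⟩
    refine ⟨⟨star c * chi F (v.2 ⬝ᵥ v.1), -v, A.neg_mem hv, ?_⟩, ?_⟩
    · rw [Matrix.UnitaryGroup.inv_val, hU, Matrix.star_eq_conjTranspose,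
        Matrix.conjTranspose_smul, errorOp_conjTranspose, smul_smul]
      rfl
    · conv_lhs => rw [← hUu]
      rw [Matrix.mulVec_mulVec, Matrix.UnitaryGroup.inv_val, Matrix.UnitaryGroup.star_mul_self,
        Matrix.one_mulVec]

namespace IsEigencharacter

variable (h : IsEigencharacter A u l)
include h

lemma mem_eigenCode : u ∈ eigenCode A l := h.apply_eq

lemma eigenvalue_ne_zero {v : (Fin n → F) × (Fin n → F)} (hv : v ∈ A) : l v ≠ 0 := fun h0 =>
  errorOp_mulVec_ne_zero h.ne_zero (by rw [h.apply_eq v hv, h0, zero_smul])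

/-- The eigenvalues form a character of `A` only up to the cocycle of `errorOp_mul`. -/
lemma eigenvalue_add {v w : (Fin n → F) × (Fin n → F)} (hv : v ∈ A) (hw : w ∈ A) :
    chi F (v.2 ⬝ᵥ w.1) * l (v + w) = l v * l w := by
  have h1 : (errorOp v.1 v.2 * errorOp w.1 w.2) *ᵥ u = (l v * l w) • u := by
    rw [← Matrix.mulVec_mulVec, h.apply_eq w hw, Matrix.mulVec_smul, h.apply_eq v hv, smul_smul,
      mul_comm]
  rw [errorOp_mul, Matrix.smul_mulVec, ← Prod.fst_add, ← Prod.snd_add,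
    h.apply_eq _ (A.add_mem hv hw), smul_smul] at h1
  exact smul_left_injective ℂ h.ne_zero h1

lemma star_eigenvalue_mul {v : (Fin n → F) × (Fin n → F)} (hv : v ∈ A) :
    star (l v) * l v = 1 := by
  have h1 : star (errorOp v.1 v.2 *ᵥ u) ⬝ᵥ (errorOp v.1 v.2 *ᵥ u) = star u ⬝ᵥ u := by
    rw [Matrix.star_mulVec, ← Matrix.dotProduct_mulVec, Matrix.mulVec_mulVec,
      errorOp_conjTranspose_mul, Matrix.one_mulVec]
  rw [h.apply_eq v hv, star_smul, smul_dotProduct, dotProduct_smul, smul_smul] at h1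
  obtain ⟨c, hc, hs⟩ := exists_isState_smul h.ne_zero
  have h2 : star u ⬝ᵥ u ≠ 0 := fun h0 => by
    rw [star_smul, smul_dotProduct, dotProduct_smul, h0] at hs
    simp at hs
  exact mul_right_cancel₀ h2 (by rw [one_mul]; exact h1)

/-- The phase is forced: eigenvalues have modulus one, so the conjugate of `l v` is the scalar that
makes the operator fix `u`. -/
lemma star_eigenvalue_smul_mem {v : (Fin n → F) × (Fin n → F)} (hv : v ∈ A) :
    ∃ U ∈ stabilizerGroup A u,
      (U : Matrix (Fin n → F) (Fin n → F) ℂ) = star (l v) • errorOp v.1 v.2 := by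
  have hl := h.star_eigenvalue_mul hv
  refine ⟨⟨star (l v) • errorOp v.1 v.2, ?_⟩, ⟨⟨_, v, hv, rfl⟩, ?_⟩, rfl⟩
  · rw [Matrix.mem_unitaryGroup_iff, Matrix.star_eq_conjTranspose, Matrix.conjTranspose_smul,
      Matrix.smul_mul, Matrix.mul_smul, errorOp_mul_conjTranspose, smul_smul, star_star, hl,
      one_smul]
  · rw [Matrix.smul_mulVec, h.apply_eq v hv, smul_smul, hl, one_smul]

lemma isStabilizerCode : IsStabilizerCode (stabilizerGroup A u) (eigenCode A l) := by
  refine ⟨?_, ?_, fun x => ⟨?_, ?_⟩⟩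
  · rintro E ⟨⟨c, v, hv, hE⟩, -⟩
    exact ⟨c, v.1, v.2, hE⟩
  · exact (Submodule.ne_bot_iff _).mpr ⟨u, h.mem_eigenCode, h.ne_zero⟩
  · rintro hx E ⟨⟨c, v, hv, hE⟩, hEu⟩
    rw [hE, Matrix.smul_mulVec, h.apply_eq v hv, smul_smul] at hEu
    have hc : c * l v = 1 := smul_left_injective ℂ h.ne_zero (by simpa using hEu)
    rw [hE, Matrix.smul_mulVec, hx v hv, smul_smul, hc, one_smul]
  · intro hx v hv
    obtain ⟨U, hU, hUv⟩ := h.star_eigenvalue_smul_mem hv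
    have h1 := hx U hU
    rw [hUv, Matrix.smul_mulVec] at h1
    conv_rhs => rw [← h1]
    rw [smul_smul, mul_comm, h.star_eigenvalue_mul hv, one_smul]

lemma exists_mem_stabilizerGroup_iff (a b : Fin n → F) :
    (∃ E ∈ stabilizerGroup A u, ∃ c : ℂ,
      (E : Matrix (Fin n → F) (Fin n → F) ℂ) = c • errorOp a b) ↔ (a, b) ∈ A := by
  constructor
  · rintro ⟨E, ⟨⟨c', v, hv, hE⟩, hEu⟩, c, hE'⟩
    have hc : c' ≠ 0 := fun h0 => h.ne_zero <| by
      rw [← hEu, hE, h0, zero_smul, Matrix.zero_mulVec]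
    have h1 : errorOp v.1 v.2 = (c'⁻¹ * c) • errorOp a b := by
      rw [mul_smul, ← hE', hE, smul_smul, inv_mul_cancel₀ hc, one_smul]
    obtain ⟨rfl, rfl⟩ := errorOp_proportional h1
    exact hv
  · intro hab
    obtain ⟨U, hU, hUv⟩ := h.star_eigenvalue_smul_mem hab
    exact ⟨U, hU, _, hUv⟩

end IsEigencharacter

/-- The orthogonal projector onto `eigenCode A l`. -/
noncomputable def projector (A : Submodule F ((Fin n → F) × (Fin n → F))) [Fintype A]
    (l : (Fin n → F) × (Fin n → F) → ℂ) : Matrix (Fin n → F) (Fin n → F) ℂ :=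
  (Fintype.card A : ℂ)⁻¹ • ∑ v : A, (l v)⁻¹ • errorOp v.1.1 v.1.2

variable [Fintype A]

/-- This is averaging over `A`: multiplication by the operator of `w` translates the summation index
by `w`, and `eigenvalue_add` absorbs the cocycle. -/
lemma IsEigencharacter.isProj_projector (h : IsEigencharacter A u l) :
    LinearMap.IsProj (eigenCode A l) (Matrix.toLin' (projector A l)) := by
  constructor
  · intro x w hw
    simp only [Matrix.toLin'_apply, projector, Matrix.smul_mulVec, Matrix.mulVec_smul,
      Matrix.sum_mulVec, Matrix.mulVec_sum, Matrix.mulVec_mulVec, errorOp_mul]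
    rw [smul_comm (l w)]
    congr 1
    conv_rhs => rw [← Equiv.sum_comp (Equiv.addLeft (⟨w, hw⟩ : A)), Finset.smul_sum]
    refine Finset.sum_congr rfl fun v _ => ?_
    have h1 := h.eigenvalue_add hw v.2
    have h2 := h.eigenvalue_ne_zero v.2
    have h3 := h.eigenvalue_ne_zero (A.add_mem hw v.2)
    simp only [Equiv.coe_addLeft, Submodule.coe_add, Prod.fst_add, Prod.snd_add, smul_smul]
    congr 1
    field_simp
    linear_combination h1
  · intro x hx
    simp only [Matrix.toLin'_apply, projector, Matrix.smul_mulVec, Matrix.sum_mulVec]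
    have h1 : ∀ v : A, (l v)⁻¹ • errorOp v.1.1 v.1.2 *ᵥ x = x := fun v => by
      rw [hx v v.2, smul_smul, inv_mul_cancel₀ (h.eigenvalue_ne_zero v.2), one_smul]
    have h2 : (Fintype.card A : ℂ) ≠ 0 := by exact_mod_cast Fintype.card_ne_zero
    simp only [h1, Finset.sum_const, Finset.card_univ]
    rw [← Nat.cast_smul_eq_nsmul ℂ, smul_smul, inv_mul_cancel₀ h2, one_smul]

lemma IsEigencharacter.trace_projector (h : IsEigencharacter A u l) :
    (projector A l).trace = Module.finrank ℂ (eigenCode A l) := by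
  rw [← h.isProj_projector.trace, Matrix.trace_toLin'_eq]

/-- The dimension is the trace of the projector, to which only the label `0` contributes. -/
lemma IsEigencharacter.finrank_mul_card (h : IsEigencharacter A u l) :
    Module.finrank ℂ (eigenCode A l) * Fintype.card A = Fintype.card F ^ n := by
  have h0 : l 0 = 1 := by
    have := h.apply_eq 0 A.zero_mem
    exact (smul_left_injective ℂ h.ne_zero (by simpa using this)).symm
  have h1 : (projector A l).trace = (Fintype.card A : ℂ)⁻¹ * (Fintype.card F ^ n : ℕ) := by
    rw [projector, Matrix.trace_smul, Matrix.trace_sum, Finset.sum_eq_single (0 : A)]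
    · simp [h0]
    · intro v _ hv
      rw [Matrix.trace_smul, errorOp_trace (fun hv' => hv (Subtype.ext hv')), smul_zero]
    · simp
  have h2 : (Fintype.card A : ℂ) ≠ 0 := by exact_mod_cast Fintype.card_ne_zero
  rw [h.trace_projector, eq_inv_mul_iff_mul_eq₀ h2] at h1
  rw [mul_comm]
  exact_mod_cast h1

lemma trace_errorOp_mul_projector {w : (Fin n → F) × (Fin n → F)} (hw : w ∉ A) :
    (errorOp w.1 w.2 * projector A l).trace = 0 := by
  rw [projector, Matrix.mul_smul, Matrix.trace_smul, Finset.mul_sum, Matrix.trace_sum]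
  refine smul_eq_zero_of_right _ (Finset.sum_eq_zero fun v _ => ?_)
  rw [Matrix.mul_smul, errorOp_mul, Matrix.trace_smul, Matrix.trace_smul, errorOp_trace,
    smul_zero, smul_zero]
  intro h0
  have h1 : w = -(v : (Fin n → F) × (Fin n → F)) := eq_neg_of_add_eq_zero_left h0
  exact hw (h1 ▸ A.neg_mem v.2)

end Stabilizer

/-! ### Expectations of errors on the code. -/

section Expectations

variable {F : Type*} [Field F] [Fintype F] [DecidableEq F] {n : ℕ}
  {A : Submodule F ((Fin n → F) × (Fin n → F))} {u : (Fin n → F) → ℂ}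
  {l : (Fin n → F) × (Fin n → F) → ℂ}

/-- Some multiple `s` of `v` acts on `x` by a phase, yet conjugation by it multiplies the error by
`chi F (symp w s) ≠ 1`. -/
lemma IsEigencharacter.expectation_eq_zero (h : IsEigencharacter A u l)
    {w v : (Fin n → F) × (Fin n → F)} (hv : v ∈ A) (hvw : symp w v ≠ 0)
    {x : (Fin n → F) → ℂ} (hx : x ∈ eigenCode A l) :
    expectation (errorOp w.1 w.2) x = 0 := by
  obtain ⟨t, ht⟩ := exists_chi_mul_ne_one hvw
  have hx' := hx _ (A.smul_mem t hv)
  have hl := h.star_eigenvalue_mul (A.smul_mem t hv)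
  set s := t • v with hs
  have hchi : chi F (symp w s) ≠ 1 := by
    rwa [hs, symp_smul_right]
  have key : expectation (errorOp w.1 w.2) x =
      chi F (symp w s) * expectation (errorOp w.1 w.2) x := by
    calc expectation (errorOp w.1 w.2) x
        = star (l s • x) ⬝ᵥ (errorOp w.1 w.2 *ᵥ (l s • x)) := by
          rw [Matrix.mulVec_smul, star_smul, smul_dotProduct, dotProduct_smul, smul_smul,
            smul_eq_mul, hl, one_mul, expectation]
      _ = star x ⬝ᵥ (((errorOp s.1 s.2)ᴴ * (errorOp w.1 w.2 * errorOp s.1 s.2)) *ᵥ x) := by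
          rw [← hx', Matrix.star_mulVec, ← Matrix.dotProduct_mulVec, Matrix.mulVec_mulVec,
            Matrix.mulVec_mulVec, Matrix.mul_assoc]
      _ = _ := by
          rw [errorOp_mul_comm, Matrix.mul_smul, ← Matrix.mul_assoc, errorOp_conjTranspose_mul,
            Matrix.one_mul, Matrix.smul_mulVec, dotProduct_smul, smul_eq_mul, expectation]
  by_contra hne
  exact hchi (mul_right_cancel₀ hne (by rw [one_mul]; exact key.symm))

lemma expectation_eq_eigenvalue {v : (Fin n → F) × (Fin n → F)} (hv : v ∈ A)
    {x : (Fin n → F) → ℂ} (hx : x ∈ eigenCode A l) (hs : IsState x) :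
    expectation (errorOp v.1 v.2) x = l v := by
  rw [expectation, hx v hv, dotProduct_smul, hs, smul_eq_mul, mul_one]

/-- The error commutes with the operators of `A`, so it preserves the code. Constant expectation
would make it a nonzero scalar there by polarization, and its product with the projector would have
nonzero trace, against `trace_errorOp_mul_projector`. -/
lemma IsEigencharacter.not_expectation_const (h : IsEigencharacter A u l)
    {w : (Fin n → F) × (Fin n → F)} (hw : w ∉ A) (hsymp : ∀ v ∈ A, symp v w = 0) (κ : ℂ) :
    ¬ ∀ x ∈ eigenCode A l, IsState x → expectation (errorOp w.1 w.2) x = κ := by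
  intro hconst
  have : Fintype A := Fintype.ofFinite A
  have hinv : ∀ x ∈ eigenCode A l, errorOp w.1 w.2 *ᵥ x ∈ eigenCode A l := by
    intro x hx v hv
    rw [Matrix.mulVec_mulVec, errorOp_mul_comm, hsymp v hv, chi_zero, one_smul,
      ← Matrix.mulVec_mulVec, hx v hv, Matrix.mulVec_smul]
  have hscalar := eq_smul_of_expectation_const hinv hconst
  have hκ : κ ≠ 0 := fun h0 => errorOp_mulVec_ne_zero h.ne_zero
    (by rw [hscalar u h.mem_eigenCode, h0, zero_smul])
  have hmul : errorOp w.1 w.2 * projector A l = κ • projector A l := by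
    apply Matrix.toLin'.injective
    refine LinearMap.ext fun x => ?_
    rw [Matrix.toLin'_mul, map_smul]
    exact hscalar _ (h.isProj_projector.map_mem x)
  have htr := trace_errorOp_mul_projector (A := A) (l := l) hw
  rw [hmul, Matrix.trace_smul, h.trace_projector, smul_eq_mul, mul_eq_zero] at htr
  have hcard := h.finrank_mul_card
  have hpos : 0 < Fintype.card F ^ n := pow_pos Fintype.card_pos n
  rcases htr with h1 | h1
  · exact hκ h1
  · rw [Nat.cast_eq_zero.mp h1, zero_mul] at hcard
    omega

end Expectations

/-! ### The Mattson-Solomon transform. -/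

section FourierTransform

lemma natCast_fin_injective {n : ℕ} : Function.Injective fun i : Fin n => ((i : ℕ) : ZMod n) := by
  intro i j hij
  have h : (((i : ℕ) : ZMod n)).val = (((j : ℕ) : ZMod n)).val := congrArg ZMod.val hij
  rw [ZMod.val_natCast_of_lt i.2, ZMod.val_natCast_of_lt j.2] at h
  exact Fin.ext h

lemma natCast_fin_bijective {n : ℕ} [NeZero n] : Function.Bijective fun i : Fin n => ((i : ℕ) : ZMod n) :=
  (Fintype.bijective_iff_injective_and_card _).mpr
    ⟨natCast_fin_injective, by rw [Fintype.card_fin, ZMod.card]⟩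

lemma sum_natCast_fin {n : ℕ} [NeZero n] {M : Type*} [AddCommMonoid M] (f : ZMod n → M) :
    ∑ i : Fin n, f (i : ℕ) = ∑ j, f j :=
  Function.Bijective.sum_comp natCast_fin_bijective f

lemma natCast_algebraicClosure_ne_zero {K : Type*} [Field K] {n : ℕ} (hn : (n : K) ≠ 0) :
    (n : AlgebraicClosure K) ≠ 0 := by
  rwa [← map_natCast (algebraMap K (AlgebraicClosure K)), Ne, map_eq_zero]

/-- The polynomial `X ^ r - X`, with `r` the order of `K`, already splits over `K`, so it acquires
no new roots in `L`. -/
lemma exists_algebraMap_eq_of_pow_card {K L : Type*} [Field K] [Fintype K] [Field L]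
    [Algebra K L] {x : L}
    (hx : x ^ Fintype.card K = x) : ∃ y, algebraMap K (L) y = x := by
  have h0 := FiniteField.X_pow_card_sub_X_ne_zero (L)
    (Fintype.one_lt_card (α := K))
  have h1 : (Polynomial.X ^ Fintype.card K - Polynomial.X : Polynomial K).Splits := by
    rw [Polynomial.splits_iff_card_roots, FiniteField.roots_X_pow_card_sub_X,
      FiniteField.X_pow_card_sub_X_natDegree_eq K Fintype.one_lt_card]
    rfl
  have h2 := h1.roots_map (algebraMap K (L))
  have h3 : x ∈ (Polynomial.map (algebraMap K (L))
      (Polynomial.X ^ Fintype.card K - Polynomial.X)).roots := by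
    simp only [Polynomial.map_sub, Polynomial.map_pow, Polynomial.map_X]
    rw [Polynomial.mem_roots h0]
    simp [hx]
  rw [h2, Multiset.mem_map] at h3
  obtain ⟨y, -, hy⟩ := h3
  exact ⟨y, hy⟩

variable {K : Type*} [Field K] {n : ℕ} [NeZero n] {α : AlgebraicClosure K}

/-- The additive character `j ↦ α ^ j` of `ZMod n`. -/
noncomputable def rootChar (hα : IsPrimitiveRoot α n) : AddChar (ZMod n) (AlgebraicClosure K) :=
  AddChar.zmodChar n hα.pow_eq_one

/-- The Mattson-Solomon transform of a word. -/
noncomputable def ft (hα : IsPrimitiveRoot α n) (c : Fin n → K) (j : ZMod n) :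
    AlgebraicClosure K :=
  ∑ i : Fin n, algebraMap K (AlgebraicClosure K) (c i) * rootChar hα (j * (i : ℕ))

variable (hα : IsPrimitiveRoot α n)
include hα

lemma rootChar_mul_natCast (j : ZMod n) (i : ℕ) : rootChar hα (j * i) = (α ^ j.val) ^ i := by
  rw [mul_comm, ← nsmul_eq_mul, AddChar.map_nsmul_eq_pow, rootChar, AddChar.zmodChar_apply]

lemma mem_cyclicCode_iff {S : Set (ZMod n)} {c : Fin n → K} :
    c ∈ cyclicCode α S ↔ ∀ j ∈ S, ft hα c j = 0 := by
  simp only [ft, rootChar_mul_natCast]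
  rfl

lemma ft_zero_right (c : Fin n → K) :
    ft hα c 0 = algebraMap K (AlgebraicClosure K) (∑ i, c i) := by
  simp [ft, map_sum]

lemma mem_evenLike_cyclicCode_iff {S : Set (ZMod n)} {c : Fin n → K} :
    c ∈ evenLike (cyclicCode α S) ↔ (∀ j ∈ S, ft hα c j = 0) ∧ ft hα c 0 = 0 := by
  rw [ft_zero_right, map_eq_zero, ← mem_cyclicCode_iff]
  rfl

lemma rootChar_isPrimitive : (rootChar hα).IsPrimitive :=
  AddChar.zmodChar_primitive_of_primitive_root n hα

lemma rootChar_eq_one_iff (j : ZMod n) : rootChar hα j = 1 ↔ j = 0 :=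
  (rootChar_isPrimitive hα).zmod_char_eq_one_iff n j

lemma sum_rootChar_mul (x : ZMod n) :
    ∑ j, rootChar hα (j * x) = if x = 0 then (n : AlgebraicClosure K) else 0 := by
  rw [AddChar.sum_mulShift x (rootChar_isPrimitive hα), ZMod.card]
  simp

lemma sum_ft_mul_rootChar (c : Fin n → K) (k : Fin n) :
    ∑ j, ft hα c j * rootChar hα (-(j * (k : ℕ))) =
      n * algebraMap K (AlgebraicClosure K) (c k) := by
  simp only [ft, Finset.sum_mul, mul_assoc]
  rw [Finset.sum_comm]
  simp only [← AddChar.map_add_eq_mul, ← mul_neg, ← mul_add, ← Finset.mul_sum,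
    sum_rootChar_mul]
  rw [Finset.sum_eq_single k]
  · simp [mul_comm]
  · intro i _ hik
    rw [if_neg, mul_zero]
    exact fun h => hik (natCast_fin_injective (add_neg_eq_zero.mp h))
  · simp

lemma eq_zero_of_sum_mul_rootChar_eq_zero (hn : (n : K) ≠ 0)
    {g : ZMod n → AlgebraicClosure K} (h : ∀ k, ∑ j, g j * rootChar hα (j * k) = 0) (j : ZMod n) :
    g j = 0 := by
  have h1 : ∑ k, (∑ i, g i * rootChar hα (i * k)) * rootChar hα (-(j * k)) = n * g j := by
    simp only [Finset.sum_mul, mul_assoc]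
    rw [Finset.sum_comm]
    simp only [← AddChar.map_add_eq_mul, ← neg_mul, ← add_mul, ← Finset.mul_sum]
    simp only [mul_comm _ (_ : ZMod n), sum_rootChar_mul]
    rw [Finset.sum_eq_single j]
    · simp [mul_comm]
    · intro i _ hij
      rw [if_neg, mul_zero]
      exact fun h => hij (add_neg_eq_zero.mp h)
    · simp
  simp only [h, zero_mul, Finset.sum_const_zero] at h1
  have hn' := natCast_algebraicClosure_ne_zero hn
  exact (mul_eq_zero.mp h1.symm).resolve_left hn'

lemma ft_pow {q : ℕ} {f : AlgebraicClosure K →+* AlgebraicClosure K} (hf : ∀ x, f x = x ^ q)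
    (c : Fin n → K) (j : ZMod n) :
    ft hα c j ^ q = ∑ i : Fin n, algebraMap K (AlgebraicClosure K) (c i ^ q) *
      rootChar hα (q * j * (i : ℕ)) := by
  rw [← hf, ft, map_sum]
  refine Finset.sum_congr rfl fun i _ => ?_
  rw [map_mul, hf, hf, map_pow, mul_assoc, ← nsmul_eq_mul, AddChar.map_nsmul_eq_pow]

/-- Parseval's identity for the Hermitian form. -/
lemma sum_ft_mul_ft_pow {q : ℕ} {f : AlgebraicClosure K →+* AlgebraicClosure K}
    (hf : ∀ x, f x = x ^ q) (hq : IsUnit (q : ZMod n)) (x c : Fin n → K) :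
    ∑ j, ft hα x (-(q * j)) * ft hα c j ^ q =
      n * algebraMap K (AlgebraicClosure K) (∑ i, x i * c i ^ q) := by
  obtain ⟨w, hw⟩ := hq
  have h1 : ∑ j, ft hα x (-(q * j)) * ft hα c j ^ q = ∑ j, ft hα x (-j) *
      ∑ i : Fin n, algebraMap K (AlgebraicClosure K) (c i ^ q) *
        rootChar hα (j * (i : ℕ)) := by
    simp only [ft_pow hα hf]
    rw [← hw]
    exact Equiv.sum_comp w.mulLeft (fun j => ft hα x (-j) *
      ∑ i : Fin n, algebraMap K (AlgebraicClosure K) (c i ^ q) * rootChar hα (j * (i : ℕ)))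
  have h2 : ∑ j, ft hα x (-j) *
      ∑ i : Fin n, algebraMap K (AlgebraicClosure K) (c i ^ q) * rootChar hα (j * (i : ℕ)) =
      ∑ i : Fin n, algebraMap K (AlgebraicClosure K) (c i ^ q) *
        ∑ j, ft hα x j * rootChar hα (-(j * (i : ℕ))) := by
    simp only [Finset.mul_sum]
    rw [Finset.sum_comm]
    refine Finset.sum_congr rfl fun i _ => ?_
    rw [← Equiv.sum_comp (Equiv.neg (ZMod n))]
    refine Finset.sum_congr rfl fun j _ => ?_
    simp only [Equiv.neg_apply, neg_neg, neg_mul]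
    ring
  rw [h1, h2, map_sum, Finset.mul_sum]
  refine Finset.sum_congr rfl fun i _ => ?_
  rw [sum_ft_mul_rootChar, map_mul]
  ring

/-- A function is the transform of a word over `K` if it commutes with the Frobenius. -/
lemma exists_ft_eq [Fintype K] (hn : (n : K) ≠ 0) (hK : IsUnit ((Fintype.card K : ℕ) : ZMod n))
    {g : ZMod n → AlgebraicClosure K}
    (hg : ∀ j, g ((Fintype.card K : ℕ) * j) = g j ^ Fintype.card K) :
    ∃ c : Fin n → K, ∀ j, ft hα c j = g j := by
  have hn' := natCast_algebraicClosure_ne_zero hn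
  set r := Fintype.card K with hr
  obtain ⟨w, hw⟩ := hK
  have hx : ∀ i : Fin n, ∃ y : K, algebraMap K (AlgebraicClosure K) y =
      (n : AlgebraicClosure K)⁻¹ * ∑ j, g j * rootChar hα (-(j * (i : ℕ))) := by
    intro i
    -- Raising the inverse transform to the power `r` amounts to reindexing by `j ↦ r * j`, so its
    -- values lie in `K`.
    apply exists_algebraMap_eq_of_pow_card
    have hfrob : ∀ x, FiniteField.frobeniusAlgHom K (AlgebraicClosure K) x = x ^ r := fun x => rfl
    rw [← hr, ← hfrob, map_mul, map_inv₀, map_natCast, map_sum]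
    conv_rhs => rw [← Equiv.sum_comp w.mulLeft]
    congr 1
    refine Finset.sum_congr rfl fun j _ => ?_
    rw [map_mul, hfrob, hfrob, Units.mulLeft_apply, hw, hg, ← AddChar.map_nsmul_eq_pow,
      nsmul_eq_mul, mul_neg, mul_assoc]
  choose c hc using hx
  refine ⟨c, fun j => ?_⟩
  rw [← sub_eq_zero]
  refine eq_zero_of_sum_mul_rootChar_eq_zero hα hn (g := fun j => ft hα c j - g j) (fun k => ?_) j
  obtain ⟨i, hi⟩ := natCast_fin_bijective.2 (-k)
  have h1 := sum_ft_mul_rootChar hα c i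
  rw [hc, mul_inv_cancel_left₀ hn'] at h1
  simp only at hi
  simp only [hi, mul_neg, neg_neg] at h1
  simp only [sub_mul, Finset.sum_sub_distrib, h1, sub_self]

end FourierTransform

/-- `U` is invariant under multiplication by `q` and contains exactly one of `s`, `-s` for every
nonzero `s`. -/
structure IsHalfSystem (q : ℕ) {n : ℕ} (U : Set (ZMod n)) : Prop where
  zero_notMem : 0 ∉ U
  mul_mem_iff : ∀ s, (q : ZMod n) * s ∈ U ↔ s ∈ U
  neg_mem_iff : ∀ s, s ≠ 0 → (-s ∈ U ↔ s ∉ U)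

/-! ### Existence of half systems and their splittings. -/

section HalfSystems

variable {n q : ℕ}

/-- Iterating `q ^ k * s = -s` an odd number `o` of times gives `s = -s`, and `2` is invertible
modulo the odd number `n`. -/
lemma neg_ne_pow_mul_self {o : ℕ} (hodd : Odd n) (ho : Odd o) (hqo : (q : ZMod n) ^ o = 1)
    {s : ZMod n} (hs : s ≠ 0) (k : ℕ) : (q : ZMod n) ^ k * s ≠ -s := by
  intro h
  have h1 : ∀ m : ℕ, (q : ZMod n) ^ (k * m) * s = (-1) ^ m * s := by
    intro m
    induction m with
    | zero => simp
    | succ m ih => rw [mul_add, mul_one, pow_add, mul_assoc, h, mul_neg, ih, pow_succ]; ring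
  have h2 := h1 o
  rw [mul_comm k, pow_mul, hqo, one_pow, one_mul, ho.neg_one_pow, neg_one_mul] at h2
  obtain ⟨m, hm⟩ := hodd
  have h3 : ((2 * m + 1 : ℕ) : ZMod n) = 0 := by rw [← hm, ZMod.natCast_self]
  push_cast at h3
  exact hs (by linear_combination (-(m : ZMod n)) * h2 + s * h3)

/-- A maximal `q`-stable set disjoint from its negative works: if it missed both `s` and `-s`, the
`q`-orbit of `s` could be adjoined. -/
lemma exists_isHalfSystem [NeZero n] {o : ℕ} (hodd : Odd n) (ho : Odd o)
    (hqo : (q : ZMod n) ^ o = 1) {T : Set (ZMod n)} (hT : ∀ s ∈ T, (q : ZMod n) * s ∈ T)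
    (hneg : ∀ s ∈ T, -s ∉ T) : ∃ U, IsHalfSystem q U ∧ T ⊆ U := by
  obtain ⟨U, hTU, hU⟩ := Set.Finite.exists_le_maximal
    (s := {U : Set (ZMod n) | (∀ s ∈ U, (q : ZMod n) * s ∈ U) ∧ ∀ s ∈ U, -s ∉ U})
    (Set.toFinite _) (a := T) ⟨hT, hneg⟩
  obtain ⟨hmul, hdis⟩ := hU.prop
  have hpow : ∀ (k : ℕ) (s), s ∈ U → (q : ZMod n) ^ k * s ∈ U := by
    intro k s hs
    induction k with
    | zero => simpa
    | succ k ih => rw [pow_succ', mul_assoc]; exact hmul _ ih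
  -- Since `q ^ o = 1`, division by `q ^ k` is multiplication by `q ^ (k * (o - 1))`.
  have hback : ∀ (k : ℕ) (s), (q : ZMod n) ^ k * s ∈ U → s ∈ U := by
    intro k s hs
    have h1 := hpow (k * (o - 1)) _ hs
    rwa [← mul_assoc, ← pow_add, show k * (o - 1) + k = o * k by
      obtain ⟨m, rfl⟩ := ho; simp; ring, pow_mul, hqo, one_pow, one_mul] at h1
  refine ⟨U, ⟨fun h0 => hdis 0 h0 (by simpa), fun s => ⟨fun h => hback 1 s (by simpa), hmul s⟩,
    fun s hs => ⟨fun h h' => hdis s h' h, fun h => ?_⟩⟩, hTU⟩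
  by_contra h'
  set W : Set (ZMod n) := U ∪ {j | ∃ k : ℕ, j = (q : ZMod n) ^ k * s} with hW
  have hWmem : W ∈ {U : Set (ZMod n) | (∀ s ∈ U, (q : ZMod n) * s ∈ U) ∧ ∀ s ∈ U, -s ∉ U} := by
    refine ⟨?_, ?_⟩
    · rintro j (hj | ⟨k, rfl⟩)
      · exact Or.inl (hmul j hj)
      · exact Or.inr ⟨k + 1, by rw [pow_succ']; ring⟩
    · rintro j (hj | ⟨k, rfl⟩) (hj' | ⟨l, hl⟩)
      · exact hdis j hj hj'
      · apply h'
        apply hback l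
        rw [mul_neg, ← hl, neg_neg]
        exact hj
      · apply h'
        apply hback k
        rwa [mul_neg]
      · have h1 := congrArg (fun x => (q : ZMod n) ^ (k * (o - 1)) * x) hl
        simp only [mul_neg, ← mul_assoc, ← pow_add] at h1
        rw [show k * (o - 1) + k = o * k by obtain ⟨m, rfl⟩ := ho; simp; ring, pow_mul, hqo,
          one_pow, one_mul] at h1
        exact neg_ne_pow_mul_self hodd ho hqo hs _ h1.symm
  have hle := hU.le_of_ge hWmem Set.subset_union_left
  exact h (hle (Or.inr ⟨0, by simp⟩))

/-- As `U` is stable under `q`, multiplication by `-q` exchanges the two halves just as negation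
does. -/
lemma IsHalfSystem.isSplitting [NeZero n] {U : Set (ZMod n)} (hU : IsHalfSystem q U)
    (hq : IsUnit (q : ZMod n)) :
    IsSplitting (q ^ 2) U {s | -s ∈ U} (-(q : ZMod n)) := by
  have hsq : ∀ s, ((q ^ 2 : ℕ) : ZMod n) * s ∈ U ↔ s ∈ U := fun s => by
    rw [Nat.cast_pow, pow_two, mul_assoc, hU.mul_mem_iff, hU.mul_mem_iff]
  have himg : ∀ V W : Set (ZMod n), (∀ s, s ∈ V ↔ -((q : ZMod n) * s) ∈ W) →
      (fun s => -(q : ZMod n) * s) '' V = W := by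
    intro V W hVW
    obtain ⟨w, hw⟩ := hq
    ext s
    constructor
    · rintro ⟨t, ht, rfl⟩
      simpa using (hVW t).mp ht
    · intro hs
      have h1 : (q : ZMod n) * (↑w⁻¹ * s) = s := by rw [← hw, Units.mul_inv_cancel_left]
      exact ⟨-(↑w⁻¹ * s), (hVW _).mpr (by rwa [mul_neg, neg_neg, h1]), by
        simp only [neg_mul_neg, h1]⟩
  refine ⟨fun s hs => (hsq s).mpr hs, fun s hs => ?_, ?_, ?_, hq.neg, himg _ _ fun s => ?_,
    himg _ _ fun s => ?_⟩
  · rw [Set.mem_ofPred_eq, ← mul_neg]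
    exact (hsq _).mpr hs
  · rw [Set.eq_empty_iff_forall_notMem]
    rintro s ⟨h1, h2⟩
    exact (hU.neg_mem_iff s fun h0 => hU.zero_notMem (h0 ▸ h1)).mp h2 h1
  · ext s
    simp only [Set.mem_union, Set.mem_ofPred_eq, Set.mem_compl_iff, Set.mem_singleton_iff]
    by_cases h0 : s = 0
    · simp [h0, hU.zero_notMem]
    · rw [hU.neg_mem_iff s h0]
      tauto
  · rw [Set.mem_ofPred_eq, neg_neg, hU.mul_mem_iff]
  · rw [Set.mem_ofPred_eq, ← mul_neg, hU.mul_mem_iff]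

end HalfSystems

/-! ### Duality and weights of duadic codes. -/

section DuadicCodes

variable {K : Type*} [Field K] {n q : ℕ} [NeZero n] {α : AlgebraicClosure K}
  {U : Set (ZMod n)}

/-- By Parseval, the Hermitian product of `x` and `c` vanishes exactly when the transforms of `x` at
`-(q * j)` and of `c` at `j` (to the power `q`) pair to zero. Transforms of even-like words live on
the nonzero `j ∉ U`, and then `-(q * j) ∈ U`. Conversely, characters cut off to these `j` are
transforms of even-like words, and there are enough of them to separate frequencies. -/
theorem hermitianDual_evenLike_cyclicCode [Fintype K] (hα : IsPrimitiveRoot α n)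
    (hn : (n : K) ≠ 0) (hK : Fintype.card K = q ^ 2) (hq : IsUnit (q : ZMod n))
    {f : AlgebraicClosure K →+* AlgebraicClosure K} (hf : ∀ x, f x = x ^ q)
    (hU : IsHalfSystem q U) :
    hermitianDual q (evenLike (cyclicCode α U)) = cyclicCode α U := by
  classical
  have hq0 : q ≠ 0 := by
    rintro rfl
    exact Fintype.card_ne_zero (hK.trans (zero_pow two_ne_zero))
  have hn' := natCast_algebraicClosure_ne_zero hn
  ext x
  constructor
  · intro hx
    rw [mem_cyclicCode_iff hα]
    have hKu : IsUnit ((Fintype.card K : ℕ) : ZMod n) := by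
      rw [hK, Nat.cast_pow]
      exact hq.pow 2
    have hKmul : ∀ s, ((Fintype.card K : ℕ) : ZMod n) * s ∈ U ↔ s ∈ U := fun s => by
      rw [hK, Nat.cast_pow, pow_two, mul_assoc, hU.mul_mem_iff, hU.mul_mem_iff]
    have key : ∀ j, (if j ≠ 0 ∧ j ∉ U then ft hα x (-(q * j)) else 0) = 0 := by
      refine eq_zero_of_sum_mul_rootChar_eq_zero hα hn fun k' => ?_
      obtain ⟨w, hw⟩ := hq
      -- Dividing by `q` compensates the power `q` in Parseval's identity.
      set k := (↑w⁻¹ : ZMod n) * k' with hk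
      have hqk : (q : ZMod n) * k = k' := by rw [← hw, hk, Units.mul_inv_cancel_left]
      obtain ⟨c, hc⟩ := exists_ft_eq hα hn hKu
        (g := fun j => if j ≠ 0 ∧ j ∉ U then rootChar hα (k * j) else 0) (fun j => by
          have h1 : ((Fintype.card K : ℕ) : ZMod n) * j ≠ 0 ↔ j ≠ 0 := by
            rw [Ne, hKu.mul_right_eq_zero]
          simp only [h1, hKmul, ite_pow, zero_pow Fintype.card_ne_zero]
          split_ifs
          · rw [← AddChar.map_nsmul_eq_pow, nsmul_eq_mul]
            congr 1
            ring
          · rfl)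
      have hcC : c ∈ evenLike (cyclicCode α U) := by
        rw [mem_evenLike_cyclicCode_iff hα]
        refine ⟨fun j hj => ?_, ?_⟩
        · rw [hc, if_neg (fun h => h.2 hj)]
        · rw [hc, if_neg (fun h => h.1 rfl)]
      have h2 := sum_ft_mul_ft_pow hα hf ⟨w, hw⟩ x c
      rw [hx c hcC, map_zero, mul_zero] at h2
      refine Eq.trans ?_ h2
      refine Finset.sum_congr rfl fun j _ => ?_
      rw [hc]
      split_ifs
      · rw [← AddChar.map_nsmul_eq_pow, nsmul_eq_mul, ← mul_assoc, hqk, mul_comm j]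
      · rw [zero_pow hq0, mul_zero, zero_mul]
    intro s hs
    obtain ⟨w, hw⟩ := hq
    have h1 : (q : ZMod n) * (↑w⁻¹ * s) = s := by rw [← hw, Units.mul_inv_cancel_left]
    have h2 : (↑w⁻¹ : ZMod n) * s ∈ U := by rwa [← hU.mul_mem_iff, h1]
    have h3 : (↑w⁻¹ : ZMod n) * s ≠ 0 := fun h0 => hU.zero_notMem (h0 ▸ h2)
    have h4 := key (-(↑w⁻¹ * s))
    rwa [if_pos, mul_neg, neg_neg, h1] at h4
    refine ⟨neg_ne_zero.mpr h3, fun h => (hU.neg_mem_iff _ h3).mp h h2⟩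
  · intro hx c hc
    rw [mem_cyclicCode_iff hα] at hx
    rw [mem_evenLike_cyclicCode_iff hα] at hc
    have h2 := sum_ft_mul_ft_pow hα hf hq x c
    rw [Finset.sum_eq_zero] at h2
    · rw [eq_comm, mul_eq_zero, map_eq_zero] at h2
      exact h2.resolve_left hn'
    · intro j _
      by_cases hj : j = 0
      · rw [hj, hc.2, zero_pow hq0, mul_zero]
      by_cases hjU : j ∈ U
      · rw [hc.1 j hjU, zero_pow hq0, mul_zero]
      · rw [hx, zero_mul]
        rw [← mul_neg, hU.mul_mem_iff, hU.neg_mem_iff j hj]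
        exact hjU

/-- The square root bound for the odd-like words of a duadic code with splitting `-1`. -/
theorem le_sq_sub_add_one_of_oddLike [DecidableEq K] (hα : IsPrimitiveRoot α n)
    (hU : IsHalfSystem q U) {c : Fin n → K} (hc : c ∈ cyclicCode α U)
    (hodd : ∑ i, c i ≠ 0) : n ≤ hammingNorm c * hammingNorm c - hammingNorm c + 1 := by
  rw [mem_cyclicCode_iff hα] at hc
  have hprod : ∀ j, j ≠ 0 → ft hα c j * ft hα c (-j) = 0 := by
    intro j hj
    by_cases hjU : j ∈ U
    · rw [hc j hjU, zero_mul]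
    · rw [hc (-j) ((hU.neg_mem_iff j hj).mpr hjU), mul_zero]
  -- The cyclic autocorrelation of `c` has only the frequency `0`, with nonzero coefficient because
  -- `c` is odd-like. It is thus a nonzero constant, so every residue is a difference of two support
  -- positions.
  have hdiff : ∀ k : ZMod n, ∃ i i' : Fin n, c i ≠ 0 ∧ c i' ≠ 0 ∧
      ((i : ℕ) : ZMod n) - ((i' : ℕ) : ZMod n) = k := by
    intro k
    by_contra hne
    push Not at hne
    have h1 : ∑ j, ft hα c j * ft hα c (-j) * rootChar hα (-(j * k)) =
        ft hα c 0 * ft hα c 0 := by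
      rw [Finset.sum_eq_single 0]
      · simp
      · intro j _ hj
        rw [hprod j hj, zero_mul]
      · simp
    have h2 : ∑ j, ft hα c j * ft hα c (-j) * rootChar hα (-(j * k)) = 0 := by
      simp only [ft, Finset.sum_mul_sum]
      simp only [Finset.sum_mul]
      rw [Finset.sum_comm]
      refine Finset.sum_eq_zero fun i _ => ?_
      rw [Finset.sum_comm]
      refine Finset.sum_eq_zero fun i' _ => ?_
      by_cases hi : c i = 0
      · simp [hi]
      by_cases hi' : c i' = 0
      · simp [hi']
      have h3 : ∀ j : ZMod n, algebraMap K (AlgebraicClosure K) (c i) *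
          rootChar hα (j * (i : ℕ)) * (algebraMap K (AlgebraicClosure K) (c i') *
          rootChar hα (-j * (i' : ℕ))) * rootChar hα (-(j * k)) =
          algebraMap K (AlgebraicClosure K) (c i) * algebraMap K (AlgebraicClosure K) (c i') *
          rootChar hα (j * ((i : ℕ) - (i' : ℕ) - k)) := by
        intro j
        rw [show j * (((i : ℕ) : ZMod n) - (i' : ℕ) - k) =
          j * (i : ℕ) + -j * (i' : ℕ) + -(j * k) by ring, AddChar.map_add_eq_mul,
          AddChar.map_add_eq_mul]
        ring
      simp only [h3, ← Finset.mul_sum, sum_rootChar_mul]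
      rw [if_neg (sub_ne_zero.mpr (hne i i' hi hi')), mul_zero]
    rw [h1, ft_zero_right, ← map_mul, map_eq_zero, mul_self_eq_zero] at h2
    exact hodd h2
  set B : Finset (Fin n) := Finset.univ.filter fun i => c i ≠ 0 with hB
  -- Equal positions yield only the residue `0`; ordered pairs of distinct positions must yield all
  -- the others.
  have hcover : (Finset.univ : Finset (ZMod n)) ⊆
      insert 0 (B.offDiag.image fun p => ((p.1 : ℕ) : ZMod n) - ((p.2 : ℕ) : ZMod n)) := by
    intro k _
    obtain ⟨i, i', hi, hi', hk⟩ := hdiff k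
    by_cases hii : i = i'
    · subst hii
      rw [← hk, sub_self]
      exact Finset.mem_insert_self _ _
    · refine Finset.mem_insert_of_mem (Finset.mem_image.mpr ⟨(i, i'), ?_, hk⟩)
      simp [hB, Finset.mem_offDiag, hi, hi', hii]
  have h1 := (Finset.card_le_card hcover).trans (Finset.card_insert_le _ _)
  rw [Finset.card_univ, ZMod.card] at h1
  have h2 := (Finset.card_image_le (s := B.offDiag)
    (f := fun p => ((p.1 : ℕ) : ZMod n) - ((p.2 : ℕ) : ZMod n)))
  rw [Finset.offDiag_card] at h2
  have h3 : hammingNorm c = B.card := rfl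
  rw [h3]
  omega

/-- A set of frequencies that is periodic modulo a divisor `N` of `n` supports a word of weight
at most `N`. -/
theorem exists_word_of_periodic [Fintype K] [DecidableEq K] (hα : IsPrimitiveRoot α n)
    (hn : (n : K) ≠ 0) (hKu : IsUnit ((Fintype.card K : ℕ) : ZMod n)) {T : Set (ZMod n)}
    (hT : T.Nonempty) (hTK : ∀ s, ((Fintype.card K : ℕ) : ZMod n) * s ∈ T ↔ s ∈ T) {N : ℕ}
    (hN : N ∣ n) (hper : ∀ s, s + (N : ZMod n) ∈ T ↔ s ∈ T) (hdis : ∀ s ∈ T, s ∉ U) :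
    ∃ c ∈ cyclicCode α U, c ≠ 0 ∧ hammingNorm c ≤ N := by
  classical
  have hn' := natCast_algebraicClosure_ne_zero hn
  obtain ⟨c, hc⟩ := exists_ft_eq hα hn hKu (g := fun j => if j ∈ T then 1 else 0) (fun j => by
    simp [hTK, ite_pow])
  refine ⟨c, ?_, ?_, ?_⟩
  · rw [mem_cyclicCode_iff hα]
    intro j hj
    rw [hc, if_neg fun h => hdis j h hj]
  · rintro rfl
    obtain ⟨t, ht⟩ := hT
    have h1 := hc t
    simp [ft, ht] at h1
  · obtain ⟨M, rfl⟩ := hN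
    have hM : 0 < M := Nat.pos_of_ne_zero fun h => NeZero.ne (N * M) (by simp [h])
    have hN0 : 0 < N := Nat.pos_of_ne_zero fun h => NeZero.ne (N * M) (by simp [h])
    -- Shifting frequencies by `N` preserves the transform and multiplies the inversion sum at `i`
    -- by `α ^ (-(N * i))`, so `c i ≠ 0` forces `N * M ∣ N * i`.
    have hsupp : ∀ i : Fin (N * M), c i ≠ 0 → M ∣ (i : ℕ) := by
      intro i hi
      have h1 := sum_ft_mul_rootChar hα c i
      have h2 : ∑ j, ft hα c j * rootChar hα (-(j * (i : ℕ))) =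
          rootChar hα (-((N : ZMod (N * M)) * (i : ℕ))) *
            ∑ j, ft hα c j * rootChar hα (-(j * (i : ℕ))) := by
        conv_lhs => rw [← Equiv.sum_comp (Equiv.addRight (N : ZMod (N * M)))]
        rw [Finset.mul_sum]
        refine Finset.sum_congr rfl fun j _ => ?_
        rw [Equiv.coe_addRight, hc, hc, add_mul, neg_add, AddChar.map_add_eq_mul]
        simp only [hper]
        ring
      rw [h1] at h2
      have h3 : (N * M : ℕ) * algebraMap K (AlgebraicClosure K) (c i) ≠ 0 :=
        mul_ne_zero hn' (by rwa [Ne, map_eq_zero])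
      have h4 : rootChar hα (-((N : ZMod (N * M)) * (i : ℕ))) = 1 :=
        mul_right_cancel₀ h3 (by rw [one_mul]; exact h2.symm)
      rw [rootChar_eq_one_iff, neg_eq_zero, ← Nat.cast_mul, ZMod.natCast_eq_zero_iff] at h4
      exact Nat.dvd_of_mul_dvd_mul_left hN0 h4
    have h5 : hammingNorm c ≤ (Finset.range N).card := by
      refine Finset.card_le_card_of_injOn (fun i : Fin (N * M) => (i : ℕ) / M) ?_ ?_
      · intro i _
        simp only [Finset.coe_range, Set.mem_Iio]
        exact Nat.div_lt_of_lt_mul (i.2.trans_eq (mul_comm N M))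
      · intro i hi j hj hij
        simp only [Finset.coe_filter, Finset.mem_univ, true_and, Set.mem_ofPred_eq] at hi hj
        have h6 : (i : ℕ) / M = (j : ℕ) / M := hij
        exact Fin.ext ((Nat.div_left_inj (hsupp i hi) (hsupp j hj)).mp h6)
    simpa using h5

/-- This supplies an odd-like word of `D` when `n` is nonzero in `K`, so that the even-like subcode
has codimension one. -/
lemma one_mem_cyclicCode (hα : IsPrimitiveRoot α n) (hU : 0 ∉ U) :
    (fun _ => 1 : Fin n → K) ∈ cyclicCode α U := by
  rw [mem_cyclicCode_iff hα]
  intro j hj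
  have h := sum_natCast_fin fun i => rootChar hα (i * j)
  rw [sum_rootChar_mul, if_neg fun h0 : j = 0 => hU (h0 ▸ hj)] at h
  simpa only [ft, map_one, one_mul, mul_comm j] using h

end DuadicCodes

lemma finrank_evenLike_add_one {K : Type*} [Field K] {n : ℕ} {D : Submodule K (Fin n → K)}
    {c : Fin n → K} (hc : c ∈ D) (hsum : ∑ i, c i ≠ 0) :
    Module.finrank K (evenLike D) + 1 = Module.finrank K D := by
  set s : D →ₗ[K] K := (∑ i, LinearMap.proj i : (Fin n → K) →ₗ[K] K) ∘ₗ D.subtype with hs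
  have hsx : ∀ x : D, s x = ∑ i, (x : Fin n → K) i := fun x => by simp [hs]
  have hsurj : Function.Surjective s :=
    LinearMap.surjective fun h => hsum (by rw [← hsx ⟨c, hc⟩, h, LinearMap.zero_apply])
  have h1 := LinearMap.finrank_range_add_finrank_ker s
  rw [LinearMap.range_eq_top.mpr hsurj, finrank_top, Module.finrank_self] at h1
  have h2 : (LinearMap.ker s).map D.subtype = evenLike D := by
    ext x
    rw [Submodule.mem_map]
    constructor
    · rintro ⟨y, hy, rfl⟩
      exact ⟨y.2, by rw [LinearMap.mem_ker, hsx] at hy; exact hy⟩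
    · rintro ⟨hx, hx'⟩
      exact ⟨⟨x, hx⟩, by rw [LinearMap.mem_ker, hsx]; exact hx', rfl⟩
  rw [← h1, ← h2, Submodule.finrank_map_subtype_eq, add_comm]

/-! ### Hermitian versus symplectic orthogonality. -/

section QuadraticExtension

variable {F K : Type*} [Field F] [Fintype F] [Field K] [Algebra F K]

lemma card_eq_sq_of_finrank_eq_two [Fintype K] (hK : Module.finrank F K = 2) :
    Fintype.card K = Fintype.card F ^ 2 := by
  rw [Module.card_eq_pow_finrank (K := F), hK]

lemma pow_card_pow_card [Fintype K] (hK : Module.finrank F K = 2) (x : K) :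
    (x ^ Fintype.card F) ^ Fintype.card F = x := by
  rw [← pow_mul, ← pow_two, ← card_eq_sq_of_finrank_eq_two hK, FiniteField.pow_card]

/-- The two conditions together say `(β ^ q) ^ 2 ≠ β ^ 2`. This gives the normal basis and keeps the
factor in `hermitian_sub_pow_card` nonzero. If `γ ^ q = -γ ≠ γ`, then `γ + 1` serves instead of `γ`.
-/
lemma exists_pow_card_ne [Fintype K] (hK : Module.finrank F K = 2) :
    ∃ β : K, β ^ Fintype.card F ≠ β ∧ β ^ Fintype.card F ≠ -β := by
  have hfrob : ∀ x : K, FiniteField.frobeniusAlgHom F K x = x ^ Fintype.card F := fun x => rfl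
  have h1 : ∃ γ : K, γ ^ Fintype.card F ≠ γ := by
    by_contra! h
    have hsurj : Function.Surjective (algebraMap F K) := fun x =>
      exists_algebraMap_eq_of_pow_card (h x)
    have h2 := Fintype.card_le_of_surjective _ hsurj
    have h3 := Fintype.one_lt_card (α := F)
    rw [card_eq_sq_of_finrank_eq_two hK] at h2
    nlinarith
  obtain ⟨γ, hγ⟩ := h1
  by_cases hneg : γ ^ Fintype.card F = -γ
  · have h3 : (γ + 1) ^ Fintype.card F = -γ + 1 := by
      rw [← hfrob, map_add, map_one, hfrob, hneg]
    refine ⟨γ + 1, fun h => hγ ?_, fun h => hγ ?_⟩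
    · rw [h3] at h
      rw [hneg]
      linear_combination h
    · rw [h3] at h
      rw [hneg]
      linear_combination (-γ) * h
  · exact ⟨γ, hγ, hneg⟩

/-- If `β ^ q = c * β` with `c` in `F`, a second Frobenius gives `c ^ 2 = 1`, hence `β ^ q = β` or
`β ^ q = -β`. -/
lemma linearIndependent_pair_pow_card [Fintype K] (hK : Module.finrank F K = 2) {β : K}
    (h1 : β ^ Fintype.card F ≠ β) (h2 : β ^ Fintype.card F ≠ -β) :
    LinearIndependent F ![β, β ^ Fintype.card F] := by
  have hβ : β ≠ 0 := by
    rintro rfl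
    exact h1 (zero_pow Fintype.card_ne_zero)
  rw [LinearIndependent.pair_iff]
  intro s t hst
  rw [Algebra.smul_def, Algebra.smul_def] at hst
  have ht : t = 0 := by
    by_contra ht
    have ht' : algebraMap F K t ≠ 0 := by rwa [Ne, map_eq_zero]
    set c := -(s / t) with hc
    have h3 : β ^ Fintype.card F = algebraMap F K c * β := by
      rw [hc, map_neg, map_div₀]
      field_simp
      linear_combination hst
    have h4 := pow_card_pow_card hK β
    rw [h3, mul_pow, ← map_pow, FiniteField.pow_card, h3] at h4
    have h5 : (algebraMap F K c - 1) * (algebraMap F K c + 1) = 0 := by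
      apply mul_right_cancel₀ hβ
      linear_combination h4
    rcases mul_eq_zero.mp h5 with h | h
    · exact h1 (by rw [h3]; linear_combination β * h)
    · exact h2 (by rw [h3]; linear_combination β * h)
  refine ⟨?_, ht⟩
  rw [ht, map_zero, zero_mul, add_zero, mul_eq_zero, map_eq_zero] at hst
  exact hst.resolve_right hβ

/-- The map `(a, b) ↦ β a + β^q b`. -/
def pairMap (n : ℕ) (β : K) : ((Fin n → F) × (Fin n → F)) →ₗ[F] (Fin n → K) where
  toFun v := fun i => algebraMap F K (v.1 i) * β + algebraMap F K (v.2 i) * β ^ Fintype.card F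
  map_add' v w := by
    ext i
    simp only [Prod.fst_add, Prod.snd_add, Pi.add_apply, map_add]
    ring
  map_smul' t v := by
    ext i
    simp only [Prod.smul_fst, Prod.smul_snd, Pi.smul_apply, smul_eq_mul, map_mul,
      RingHom.id_apply]
    rw [Algebra.smul_def]
    ring

lemma pairMap_apply {n : ℕ} (β : K) (v : (Fin n → F) × (Fin n → F)) (i : Fin n) :
    pairMap n β v i =
      algebraMap F K (v.1 i) * β + algebraMap F K (v.2 i) * β ^ Fintype.card F := rfl

variable {n : ℕ} {β : K}

lemma pairMap_apply_eq_zero_iff (hβ : LinearIndependent F ![β, β ^ Fintype.card F])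
    (v : (Fin n → F) × (Fin n → F)) (i : Fin n) :
    pairMap n β v i = 0 ↔ v.1 i = 0 ∧ v.2 i = 0 := by
  constructor
  · intro h
    rw [pairMap_apply, ← Algebra.smul_def, ← Algebra.smul_def] at h
    exact LinearIndependent.pair_iff.mp hβ _ _ h
  · rintro ⟨h1, h2⟩
    simp [pairMap_apply, h1, h2]

lemma errorWeight_eq_hammingNorm [DecidableEq F] [DecidableEq K]
    (hβ : LinearIndependent F ![β, β ^ Fintype.card F]) (v : (Fin n → F) × (Fin n → F)) :
    errorWeight v.1 v.2 = hammingNorm (pairMap n β v) := by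
  rw [errorWeight, hammingNorm]
  congr 1
  ext i
  simp only [Finset.mem_filter, Finset.mem_univ, true_and, Ne, pairMap_apply_eq_zero_iff hβ]
  tauto

/-- `pairMap` as an equivalence, for a normal basis `(β, β^q)`. -/
noncomputable def pairEquiv (hK : Module.finrank F K = 2)
    (hβ : LinearIndependent F ![β, β ^ Fintype.card F]) (n : ℕ) :
    ((Fin n → F) × (Fin n → F)) ≃ₗ[F] (Fin n → K) :=
  haveI : Module.Finite F K := Module.finite_of_finrank_eq_succ hK
  LinearEquiv.ofInjectiveOfFinrankEq (pairMap n β)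
    (by
      rw [injective_iff_map_eq_zero]
      intro v hv
      have h := fun i => (pairMap_apply_eq_zero_iff hβ v i).mp (congrFun hv i)
      exact Prod.ext (funext fun i => (h i).1) (funext fun i => (h i).2))
    (by
      rw [Module.finrank_prod, Module.finrank_pi_fintype, Module.finrank_pi_fintype]
      simp [hK]
      ring)

lemma pairEquiv_apply (hK : Module.finrank F K = 2)
    (hβ : LinearIndependent F ![β, β ^ Fintype.card F]) (v : (Fin n → F) × (Fin n → F)) :
    pairEquiv hK hβ n v = pairMap n β v := rfl

lemma hermitian_sub_pow_card [Fintype K] (hK : Module.finrank F K = 2)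
    (v w : (Fin n → F) × (Fin n → F)) :
    (∑ i, pairMap n β v i * pairMap n β w i ^ Fintype.card F) -
      (∑ i, pairMap n β v i * pairMap n β w i ^ Fintype.card F) ^ Fintype.card F =
      ((β ^ Fintype.card F) ^ 2 - β ^ 2) * algebraMap F K (symp v w) := by
  have hfrob : ∀ x : K, FiniteField.frobeniusAlgHom F K x = x ^ Fintype.card F := fun x => rfl
  simp only [symp, dotProduct, ← hfrob, map_sum, map_sub, map_mul, Finset.mul_sum,
    ← Finset.sum_sub_distrib]
  refine Finset.sum_congr rfl fun i _ => ?_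
  simp only [pairMap_apply, ← hfrob, map_add, map_mul, AlgHom.commutes]
  simp only [hfrob, pow_card_pow_card hK]
  ring

/-- Symplectic orthogonality to a `K`-linear code is Hermitian orthogonality. -/
lemma forall_symp_eq_zero_iff [Fintype K] (hK : Module.finrank F K = 2)
    (h1 : β ^ Fintype.card F ≠ β) (h2 : β ^ Fintype.card F ≠ -β)
    {C : Submodule K (Fin n → K)} {v : (Fin n → F) × (Fin n → F)} :
    (∀ w, pairMap n β w ∈ C → symp w v = 0) ↔
      pairMap n β v ∈ hermitianDual (Fintype.card F) C := by
  have hβ := linearIndependent_pair_pow_card hK h1 h2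
  have hne : (β ^ Fintype.card F) ^ 2 - β ^ 2 ≠ 0 := by
    rw [sq_sub_sq]
    exact mul_ne_zero (fun h => h2 (eq_neg_of_add_eq_zero_left h)) (sub_ne_zero.mpr h1)
  constructor
  · intro h c hc
    -- Symplectic orthogonality to `t • c` only says that `t ^ q` times the Hermitian product is
    -- fixed by Frobenius. Comparing `t = 1` with `t = β` forces the product to vanish.
    have key : ∀ t : K, (t ^ Fintype.card F * ∑ i, pairMap n β v i * c i ^ Fintype.card F) ^
        Fintype.card F =
        t ^ Fintype.card F * ∑ i, pairMap n β v i * c i ^ Fintype.card F := by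
      intro t
      obtain ⟨w, hw⟩ := (pairEquiv hK hβ n).surjective (t • c)
      rw [pairEquiv_apply] at hw
      have h3 := hermitian_sub_pow_card (β := β) hK v w
      rw [symp_swap w v, h w (hw ▸ C.smul_mem t hc), neg_zero, map_zero, mul_zero, hw] at h3
      have h4 : ∑ i, pairMap n β v i * (t • c) i ^ Fintype.card F =
          t ^ Fintype.card F * ∑ i, pairMap n β v i * c i ^ Fintype.card F := by
        rw [Finset.mul_sum]
        refine Finset.sum_congr rfl fun i _ => ?_
        rw [Pi.smul_apply, smul_eq_mul, mul_pow]
        ring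
      rw [h4] at h3
      exact (sub_eq_zero.mp h3).symm
    have h5 := key 1
    have h6 := key β
    rw [one_pow, one_mul] at h5
    rw [mul_pow, h5, pow_card_pow_card hK] at h6
    by_contra h7
    exact h1 (mul_right_cancel₀ h7 h6).symm
  · intro h w hw
    have h3 := hermitian_sub_pow_card (β := β) hK v w
    rw [h _ hw, zero_pow Fintype.card_ne_zero, sub_zero, eq_comm, mul_eq_zero, map_eq_zero] at h3
    rw [symp_swap, h3.resolve_left hne, neg_zero]

end QuadraticExtension

/-! ### Dimension of the symplectic dual. -/

section SymplecticDual

variable {F : Type*} [Field F] {n : ℕ}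

/-- The symplectic form as a bilinear form. -/
def sympForm (F : Type*) [Field F] (n : ℕ) :
    LinearMap.BilinForm F ((Fin n → F) × (Fin n → F)) :=
  LinearMap.mk₂ F symp
    (fun u v w => by simp only [symp, Prod.snd_add, Prod.fst_add, add_dotProduct, dotProduct_add]
                     ring)
    (fun c v w => by simp only [symp, Prod.smul_snd, Prod.smul_fst, smul_dotProduct,
                       dotProduct_smul, smul_sub])
    (fun u v w => by simp only [symp, Prod.snd_add, Prod.fst_add, add_dotProduct, dotProduct_add]
                     ring)
    (fun c v w => by simp only [symp, Prod.smul_snd, Prod.smul_fst, smul_dotProduct,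
                       dotProduct_smul, smul_sub])

lemma sympForm_ker : LinearMap.ker (sympForm F n) = ⊥ := by
  rw [LinearMap.ker_eq_bot']
  intro v hv
  have h : ∀ w, symp v w = 0 := fun w => LinearMap.congr_fun hv w
  refine Prod.ext (funext fun i => ?_) (funext fun i => ?_)
  · simpa [symp] using h (0, Pi.single i 1)
  · simpa [symp] using h (Pi.single i 1, 0)

lemma finrank_add_finrank_sympDual (A B : Submodule F ((Fin n → F) × (Fin n → F)))
    (hB : ∀ v, v ∈ B ↔ ∀ w ∈ A, symp w v = 0) :
    Module.finrank F A + Module.finrank F B = 2 * n := by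
  have h1 : B = (sympForm F n).orthogonal A := by
    ext v
    rw [hB, LinearMap.BilinForm.mem_orthogonal_iff]
    rfl
  rw [h1, LinearMap.BilinForm.finrank_add_finrank_orthogonal', sympForm_ker, inf_bot_eq,
    finrank_bot, Module.finrank_prod]
  simp
  ring

end SymplecticDual

/-! ### Distance and purity as minimum weights. -/

section Distances

variable {F : Type*} [Field F] [Fintype F] [DecidableEq F] {n : ℕ}
  {A : Submodule F ((Fin n → F) × (Fin n → F))} {u : (Fin n → F) → ℂ}
  {l : (Fin n → F) × (Fin n → F) → ℂ}

lemma IsEigencharacter.exists_isState (h : IsEigencharacter A u l) :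
    ∃ x ∈ eigenCode A l, IsState x := by
  obtain ⟨c, -, hs⟩ := exists_isState_smul h.ne_zero
  exact ⟨c • u, (eigenCode A l).smul_mem c h.mem_eigenCode, hs⟩

/-- Expectations are constant for labels in `A` (an eigenvalue) and for labels outside the
symplectic dual (zero); `not_expectation_const` excludes all the rest. -/
lemma IsEigencharacter.detects_iff (h : IsEigencharacter A u l) (t : ℕ) :
    Detects (eigenCode A l) t ↔ ∀ w ∈ {w : (Fin n → F) × (Fin n → F) |
      w ∉ A ∧ ∀ v ∈ A, symp v w = 0}, t ≤ errorWeight w.1 w.2 := by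
  constructor
  · rintro hdet w ⟨hwA, hw⟩
    by_contra! hlt
    obtain ⟨y, hy, hys⟩ := h.exists_isState
    exact h.not_expectation_const hwA hw (expectation (errorOp w.1 w.2) y)
      fun x hx hxs => hdet w.1 w.2 hlt x hx y hy hxs hys
  · intro hw a b hab x hx y hy hxs hys
    by_cases hA : (a, b) ∈ A
    · rw [expectation_eq_eigenvalue hA hx hxs, expectation_eq_eigenvalue hA hy hys]
    · have h1 : ¬ ∀ v ∈ A, symp v (a, b) = 0 := fun h1 => hab.not_ge (hw (a, b) ⟨hA, h1⟩)
      push Not at h1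
      obtain ⟨v, hv, hne⟩ := h1
      have hne' : symp (a, b) v ≠ 0 := by rwa [symp_swap v, neg_ne_zero]
      rw [h.expectation_eq_zero hv hne' hx, h.expectation_eq_zero hv hne' hy]

/-- Nonzero labels give traceless errors, so purity asks for expectation zero. Labels in `A` now
fail too, their eigenvalues being nonzero. -/
lemma IsEigencharacter.isPureTo_iff (h : IsEigencharacter A u l) (t : ℕ) :
    IsPureTo (eigenCode A l) t ↔ ∀ w ∈ {w : (Fin n → F) × (Fin n → F) |
      w ≠ 0 ∧ ∀ v ∈ A, symp v w = 0}, t ≤ errorWeight w.1 w.2 := by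
  constructor
  · rintro hpure w ⟨hw0, hw⟩
    by_contra! hlt
    have hexp : ∀ x ∈ eigenCode A l, IsState x → expectation (errorOp w.1 w.2) x = 0 := by
      intro x hx hxs
      rw [hpure w.1 w.2 hlt x hx hxs, errorOp_trace hw0, mul_zero]
    by_cases hA : w ∈ A
    · obtain ⟨y, hy, hys⟩ := h.exists_isState
      have h1 := hexp y hy hys
      rw [expectation_eq_eigenvalue hA hy hys] at h1
      exact h.eigenvalue_ne_zero hA h1
    · exact h.not_expectation_const hA hw 0 hexp
  · intro hw a b hab x hx hxs
    by_cases h0 : (a, b) = (0 : (Fin n → F) × (Fin n → F))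
    · obtain ⟨rfl, rfl⟩ := Prod.mk.inj h0
      have hq : (Fintype.card F : ℂ) ^ n ≠ 0 :=
        pow_ne_zero n (by exact_mod_cast Fintype.card_ne_zero)
      rw [expectation, errorOp_zero, Matrix.one_mulVec, hxs, Matrix.trace_one,
        Fintype.card_fun, Fintype.card_fin, Nat.cast_pow, inv_mul_cancel₀ hq]
    · have h1 : ¬ ∀ v ∈ A, symp v (a, b) = 0 := fun h1 => hab.not_ge (hw (a, b) ⟨h0, h1⟩)
      push Not at h1
      obtain ⟨v, hv, hne⟩ := h1
      have hne' : symp (a, b) v ≠ 0 := by rwa [symp_swap v, neg_ne_zero]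
      rw [h.expectation_eq_zero (w := (a, b)) hv hne' hx, errorOp_trace h0, mul_zero]

end Distances

lemma exists_isGreatest_forall_le {ι : Type*} {W : Set ι} (hW : W.Nonempty) (f : ι → ℕ) :
    ∃ w ∈ W, IsGreatest {t | ∀ w ∈ W, t ≤ f w} (f w) := by
  obtain ⟨w, hw, hmin⟩ := WellFounded.has_min (measure f).wf W hW
  exact ⟨w, hw, fun w' hw' => not_lt.mp (hmin w' hw'), fun t ht => ht w hw⟩

/-! ### Construction of the quantum duadic code. -/

section Construction

variable {F K : Type*} [Field F] [Fintype F] [DecidableEq F] [Field K] [Fintype K]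
  [DecidableEq K] [Algebra F K]

/-- The Hermitian construction for a code `C ⊂ D = C^{⊥h}` of codimension one. -/
theorem exists_hermitianConstruction (hK : Module.finrank F K = 2) {n : ℕ}
    {D : Submodule K (Fin n → K)}
    (hD : hermitianDual (Fintype.card F) (evenLike D) = D)
    {c₀ : Fin n → K} (hc₀ : c₀ ∈ D) (hc₀' : ∑ i, c₀ i ≠ 0) :
    ∃ (Q : Submodule ℂ ((Fin n → F) → ℂ)) (d d' : ℕ),
      IsHermitianConstruction (evenLike D) Q ∧ IsStabilizerCodeWithParams Q 1 d ∧
      IsGreatest {t | IsPureTo Q t} d' ∧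
      (∃ c ∈ D, ∑ i, c i ≠ 0 ∧ hammingNorm c = d) ∧
      ∀ c ∈ D, c ≠ 0 → d' ≤ hammingNorm c := by
  obtain ⟨β, h1, h2⟩ := exists_pow_card_ne hK
  have hβ := linearIndependent_pair_pow_card hK h1 h2
  set e := pairEquiv hK hβ n with he
  set A := ((evenLike D).restrictScalars F).comap (pairMap n β) with hA
  set B := (D.restrictScalars F).comap (pairMap n β) with hB
  have hmemA : ∀ v, v ∈ A ↔ pairMap n β v ∈ evenLike D := fun v => Iff.rfl
  have hmemB : ∀ v, v ∈ B ↔ ∀ w ∈ A, symp w v = 0 := fun v => by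
    rw [show v ∈ B ↔ pairMap n β v ∈ D from Iff.rfl]
    conv_lhs => rw [← hD]
    exact (forall_symp_eq_zero_iff hK h1 h2).symm
  have hle : evenLike D ≤ D := fun x hx => hx.1
  have hiso : ∀ v ∈ A, ∀ w ∈ A, symp v w = 0 := fun v hv w hw => (hmemB w).mp (hle hw) v hv
  obtain ⟨u, l, h⟩ := exists_isEigencharacter hiso
  have hsub : ∀ V : Submodule K (Fin n → K),
      Module.finrank F ((V.restrictScalars F).comap (pairMap n β)) =
        2 * Module.finrank K V := by
    intro V
    have h3 : (V.restrictScalars F).comap (pairMap n β) =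
        (V.restrictScalars F).map (e.symm : (Fin n → K) →ₗ[F] _) := by
      rw [Submodule.map_equiv_eq_comap_symm]
      rfl
    rw [h3, LinearEquiv.finrank_map_eq, ← hK]
    exact (Module.finrank_mul_finrank F K V).symm
  have hdim := finrank_add_finrank_sympDual A B hmemB
  rw [hA, hB, hsub, hsub] at hdim
  have hdim' := finrank_evenLike_add_one hc₀ hc₀'
  have : Fintype A := Fintype.ofFinite A
  have hcard := h.finrank_mul_card
  -- The `F`-dimensions of `A` and `B` sum to `2 * n` and differ by `2`, so that of `A` is `n - 1`.
  rw [Module.card_eq_pow_finrank (K := F) (V := A), show Module.finrank F A = n - 1 by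
    rw [hA, hsub]; omega] at hcard
  have hrank : Module.finrank ℂ (eigenCode A l) = Fintype.card F ^ 1 := by
    apply Nat.eq_of_mul_eq_mul_right (pow_pos (Fintype.card_pos (α := F)) (n - 1))
    rw [hcard, ← pow_add]
    congr 1
    omega
  have hnotA : ∀ v, v ∈ B → (v ∉ A ↔ ∑ i, pairMap n β v i ≠ 0) := by
    intro v hv
    rw [hmemA]
    exact not_congr ⟨fun h => h.2, fun h => ⟨hv, h⟩⟩
  have hlift : ∀ c : Fin n → K, ∃ v, pairMap n β v = c := e.surjective
  obtain ⟨w, ⟨hwA, hw⟩, hmin⟩ := exists_isGreatest_forall_le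
    (W := {w | w ∉ A ∧ ∀ v ∈ A, symp v w = 0}) (by
      obtain ⟨v, hv⟩ := hlift c₀
      have hvB : v ∈ B := by
        rw [hB, Submodule.mem_comap, hv]
        exact hc₀
      exact ⟨v, (hnotA v hvB).mpr (by rwa [hv]), (hmemB v).mp hvB⟩)
    (fun w => errorWeight w.1 w.2)
  obtain ⟨w', -, hmin'⟩ := exists_isGreatest_forall_le
    (W := {w | w ≠ 0 ∧ ∀ v ∈ A, symp v w = 0})
    ⟨w, fun h0 => hwA (h0 ▸ A.zero_mem), hw⟩ (fun w => errorWeight w.1 w.2)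
  have hwB := (hmemB w).mpr hw
  refine ⟨eigenCode A l, errorWeight w.1 w.2, errorWeight w'.1 w'.2, ⟨hle.trans hD.ge, β, hβ, stabilizerGroup A u,
    h.isStabilizerCode, fun a b => h.exists_mem_stabilizerGroup_iff a b⟩,
    ⟨⟨_, h.isStabilizerCode⟩, hrank, ?_⟩, ?_,
    ⟨pairMap n β w, hwB, (hnotA w hwB).mp hwA, (errorWeight_eq_hammingNorm hβ w).symm⟩, ?_⟩
  · simpa only [IsMinDistance, h.detects_iff] using hmin
  · simpa only [h.isPureTo_iff] using hmin'
  · intro c hc hc0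
    obtain ⟨v, rfl⟩ := hlift c
    rw [← errorWeight_eq_hammingNorm hβ v]
    exact hmin'.1 v ⟨fun h0 => hc0 (by rw [h0, map_zero]), (hmemB v).mp hc⟩

/-- For every divisor `N > 1` of the length there is a Hermitian quantum duadic code that is pure
to at most `N` and satisfies the square root bound. -/
theorem exists_quantumDuadicCode_purity_le (hK : Module.finrank F K = 2) {n : ℕ} (hn : 1 < n)
    (hodd : Odd n) (hord : Odd (orderOf ((Fintype.card F : ℕ) : ZMod n))) {N : ℕ}
    (hN : N ∣ n) (hN1 : 1 < N) :
    ∃ (Q : Submodule ℂ ((Fin n → F) → ℂ)) (d d' : ℕ),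
      IsHermitianQuantumDuadicCode K Q ∧ IsStabilizerCodeWithParams Q 1 d ∧
      IsGreatest {t | IsPureTo Q t} d' ∧ d' ≤ N ∧ n ≤ d * d - d + 1 := by
  have : NeZero n := ⟨by omega⟩
  set q := Fintype.card F with hqdef
  set o := orderOf (q : ZMod n) with ho
  have hqo : (q : ZMod n) ^ o = 1 := pow_orderOf_eq_one _
  -- An odd order is positive, so some positive power of `q` is `1`.
  have hqu : IsUnit (q : ZMod n) := IsUnit.of_pow_eq_one hqo hord.pos.ne'
  have hcard : Fintype.card K = q ^ 2 := card_eq_sq_of_finrank_eq_two hK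
  have hKu : IsUnit ((Fintype.card K : ℕ) : ZMod n) := by
    rw [hcard, Nat.cast_pow]
    exact hqu.pow 2
  have hnK : (n : K) ≠ 0 := by
    intro h0
    obtain ⟨a, b, hab⟩ := Nat.isCoprime_iff_coprime.mpr ((ZMod.isUnit_iff_coprime q n).mp hqu)
    have h1 := congrArg (Int.cast : ℤ → K) hab
    have h2 : (q : K) = 0 := by
      rw [← map_natCast (algebraMap F K), hqdef, Nat.cast_card_eq_zero, map_zero]
    push_cast at h1
    rw [h0, h2, mul_zero, mul_zero, add_zero] at h1
    exact zero_ne_one h1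
  have : NeZero (n : K) := ⟨hnK⟩
  obtain ⟨α, hα⟩ := HasEnoughRootsOfUnity.exists_primitiveRoot (AlgebraicClosure K) n
  let π : ZMod n →+* ZMod N := ZMod.castHom hN (ZMod N)
  have hπq : π (q : ZMod n) = q := map_natCast π q
  have hqoN : (q : ZMod N) ^ o = 1 := by rw [← hπq, ← map_pow, hqo, map_one]
  have : Fact (1 < N) := ⟨hN1⟩
  have hnegN : ∀ k l : ℕ, (q : ZMod N) ^ k ≠ -(q : ZMod N) ^ l := by
    intro k l hkl
    apply neg_ne_pow_mul_self (hodd.of_dvd_nat hN) hord hqoN (one_ne_zero (α := ZMod N))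
      (k + l * (o - 1))
    rw [mul_one, pow_add, hkl, neg_mul, ← pow_add, show l + l * (o - 1) = o * l by
      obtain ⟨m, hm⟩ := hord; rw [hm]; simp; ring, pow_mul, hqoN, one_pow]
  -- `T` must avoid the defining set, so `-T` is put into `U`; by `hnegN` it is disjoint from its
  -- negative.
  set T : Set (ZMod n) := {j | ∃ k : ℕ, π j = (q : ZMod N) ^ k} with hTdef
  obtain ⟨U, hU, hTU⟩ := exists_isHalfSystem (T := {j | -j ∈ T}) hodd hord hqo
    (by
      rintro s ⟨k, hk⟩
      refine ⟨k + 1, ?_⟩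
      rw [← mul_neg, map_mul, hk, hπq, pow_succ'])
    (by
      rintro s ⟨k, hk⟩ ⟨m, hm⟩
      rw [neg_neg] at hm
      rw [map_neg, hm] at hk
      exact hnegN k m hk.symm)
  have hTU' : ∀ s ∈ T, s ∉ U := by
    intro s hs
    have h1 : -s ∈ U := hTU (by rwa [Set.mem_ofPred_eq, neg_neg])
    exact (hU.neg_mem_iff s fun h0 => hU.zero_notMem (by rwa [h0, neg_zero] at h1)).mp h1
  have hTK : ∀ s, ((Fintype.card K : ℕ) : ZMod n) * s ∈ T ↔ s ∈ T := by
    intro s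
    have h1 : π (((Fintype.card K : ℕ) : ZMod n) * s) = (q : ZMod N) ^ 2 * π s := by
      rw [map_mul, map_natCast, hcard, Nat.cast_pow]
    constructor
    · rintro ⟨k, hk⟩
      refine ⟨2 * (o - 1) + k, ?_⟩
      rw [pow_add, ← hk, h1, ← mul_assoc, ← pow_add, show 2 * (o - 1) + 2 = o * 2 by
        obtain ⟨m, hm⟩ := hord; rw [hm]; simp; ring, pow_mul, hqoN, one_pow, one_mul]
    · rintro ⟨k, hk⟩
      exact ⟨2 + k, by rw [h1, hk, pow_add]⟩
  obtain ⟨c, hcD, hc0, hcN⟩ := exists_word_of_periodic (U := U) hα hnK hKu (T := T)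
    ⟨1, 0, by rw [map_one, pow_zero]⟩ hTK hN
    (fun s => by simp only [hTdef, Set.mem_ofPred_eq, map_add, map_natCast, ZMod.natCast_self,
      add_zero]) hTU'
  have hdual := hermitianDual_evenLike_cyclicCode
    (f := (FiniteField.frobeniusAlgHom F (AlgebraicClosure K) : _ →+* _)) hα hnK hcard hqu
    (fun x => rfl) hU
  obtain ⟨Q, d, d', hQ, hparam, hpure, ⟨w, hwD, hw, hwd⟩, hd'⟩ :=
    exists_hermitianConstruction hK hdual
      (one_mem_cyclicCode hα hU.zero_notMem) (by simpa using hnK)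
  refine ⟨Q, d, d', ⟨α, U, {s | -s ∈ U}, hα, hU.isSplitting hqu, hdual, hQ⟩, hparam, hpure,
    (hd' c hcD hc0).trans hcN, ?_⟩
  rw [← hwd]
  exact le_sq_sub_add_one_of_oddLike hα hU hwD hw

end Construction

end QDuadic

/-! ### Choice of the divisor and degeneracy. -/

theorem theorem6 {F K : Type*} [Field F] [Fintype F] [DecidableEq F] [Field K] [Algebra F K]
    (hK : Module.finrank F K = 2) (q : ℕ) (hq : Fintype.card F = q)
    (n : ℕ) (hn : 1 < n) (hodd : Odd n)
    (hord : Odd (orderOf (q : ZMod n)))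
    (hmod : ∀ p ∈ n.primeFactors, p ≡ 3 [MOD 4])
    (z : ℕ → ℕ)
    (hz : ∀ p ∈ n.primeFactors,
      p ^ z p ∣ q ^ (2 * orderOf ((q : ZMod p) ^ 2)) - 1 ∧
      ¬ p ^ (z p + 1) ∣ q ^ (2 * orderOf ((q : ZMod p) ^ 2)) - 1)
    (hm : ∀ p ∈ n.primeFactors, 2 * z p < n.factorization p) :
    ∃ (Q : Submodule ℂ ((Fin n → F) → ℂ)) (d d' : ℕ),
      QDuadic.IsHermitianQuantumDuadicCode K Q ∧
      QDuadic.IsStabilizerCodeWithParams Q 1 d ∧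
      QDuadic.IsDegenerate Q ∧
      IsGreatest {t | QDuadic.IsPureTo Q t} d' ∧
      d' ≤ n.primeFactors.inf' (Nat.nonempty_primeFactors.mpr hn) (fun p => p ^ z p) ∧
      n.primeFactors.inf' (Nat.nonempty_primeFactors.mpr hn) (fun p => p ^ z p) < d ∧
      (n : ℤ) ≤ (d : ℤ) ^ 2 - d + 1 := by
  classical
  subst hq
  have : Module.Finite F K := Module.finite_of_finrank_eq_succ hK
  have : Finite K := Module.finite_of_finite F
  have : Fintype K := Fintype.ofFinite K
  obtain ⟨p, hp, hmin⟩ := Finset.exists_mem_eq_inf' (Nat.nonempty_primeFactors.mpr hn)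
    (fun p => p ^ z p)
  rw [hmin]
  have hpp := Nat.prime_of_mem_primeFactors hp
  -- The exponent is a multiple of the order of `q ^ 2` modulo `p`, so `p` itself divides the
  -- number.
  have hz0 : z p ≠ 0 := by
    intro h0
    have h1 := (hz p hp).2
    rw [h0, zero_add, pow_one] at h1
    apply h1
    have hone : 1 ≤ Fintype.card F ^ (2 * orderOf ((Fintype.card F : ZMod p) ^ 2)) :=
      Nat.one_le_pow _ _ Fintype.card_pos
    rw [← ZMod.natCast_eq_zero_iff, Nat.cast_sub hone, Nat.cast_pow, pow_mul,
      pow_orderOf_eq_one, Nat.cast_one, sub_self]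
  have hdvd : p ^ (2 * z p + 1) ∣ n :=
    (hpp.pow_dvd_iff_le_factorization (by omega)).mpr (hm p hp)
  have hN : p ^ z p ∣ n := (pow_dvd_pow p (by omega)).trans hdvd
  have hlt : p ^ z p * p ^ z p < n := by
    rw [← pow_add]
    exact (Nat.pow_lt_pow_right hpp.one_lt (by omega)).trans_le (Nat.le_of_dvd (by omega) hdvd)
  obtain ⟨Q, d, d', hQ, hparam, hpure, hd', hbound⟩ :=
    QDuadic.exists_quantumDuadicCode_purity_le hK hn hodd hord hN (Nat.one_lt_pow hz0 hpp.one_lt)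
  have hd : p ^ z p < d := by
    by_contra! hle
    have h1 := Nat.mul_le_mul hle hle
    have h2 : d * d - d + 1 ≤ p ^ z p * p ^ z p := by
      -- From `d ≤ N` the square root bound would give `n ≤ N * N`; the case `d = 0` is separate, as
      -- there `d * d - d + 1` exceeds `d * d`.
      rcases Nat.eq_zero_or_pos d with h0 | h0
      · rw [h0]
        exact Nat.mul_pos (pow_pos hpp.pos _) (pow_pos hpp.pos _)
      · have h3 : d ≤ d * d := Nat.le_mul_of_pos_left d h0
        omega
    omega
  refine ⟨Q, d, d', hQ, hparam, ⟨d, hparam.2.2, fun h => ?_⟩, hpure, hd', hd, ?_⟩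
  -- Purity to `d` would give `d ≤ d' ≤ p ^ z p < d`.
  · exact absurd (hpure.2 h) (by omega)
  · have h3 : d ≤ d * d := Nat.le_mul_of_pos_left d (by omega)
    zify [h3] at hbound
    linarith [sq (d : ℤ)]
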